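/- **Setting.** Let $G=(V,E)$ be a finite undirected graph with $n=|V|\ge 3$ and positive real edge weights, let $d\ge 2$ be an integer, $c\ge 1$ a real constant and $\rho\ge 0$ a real parameter. Put $k=\ln n$ and $s=4e\,d^{c+1}\ln^2 n+1$. Write $\delta_H(x,y)$ for the length of a shortest path from $x$ to $y$ in $H$ ($+\infty$ if there is none), and $\mathrm{dep}_T(x)$ for the weighted depth of $x$ in a rooted tree $T$. A vertex set is identified with the corresponding singleton or tree where convenient. **Tree covers.** For disjoint $R,S\subseteq V$, an *$S$-restricted tree cover* of $G-R$ is a family of trees $T(x)$ ($x\in S$), each a subgraph of $G-R$ rooted at $x$, such that (i) for all $u\in S$ and $v\in V\setminus R$ that are connected in $G-R$ there is $x\in S$ with $u,v\in V(T(x))$ and $\mathrm{dep}_{T(x)}(u)+\mathrm{dep}_{T(x)}(v)\le(2k-1)\,\delta_{G-R}(u,v)$, and (ii) every vertex lies in at most $kn^{1/k}(\ln n+1)$ of the trees. For all $R,S\subseteq V$ fix an $(S\setminus R)$-restricted tree cover $\mathcal T_R(S)$ of $G-R$, and let $\mathcal T(S)=\mathcal T_\varnothing(S)$. A *trunk vertex*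 of a tree $T$ of a cover with source set $S'$ is a vertex on the path in $T$ between two vertices of $S'\cap V(T)$. The *pseudo-degree* of a vertex in $T$ is its degree in the subgraph of $T$ induced by the trunk vertices ($0$ if it is not a trunk vertex). $\mathrm{Hi}(\cdot)$ is the set of vertices of pseudo-degree $>s$ in some tree of the cover. **Hierarchy tree and path finding.** The root of the hierarchy tree is $V$. A node $U$ with $\mathrm{Hi}(\mathcal T(U))=\varnothing$ is a leaf. Any other node $U$ has the children $W_1=\mathrm{Hi}(\mathcal T(U))$ and $W_i=W_{i-1}\cup\mathrm{Hi}(\mathcal T_{W_{i-1}}(U))$ for $2\le i\le d$. For $D\subseteq V$ with $|D|\le d$ the algorithm starts with $U_1=V$. At $U_i$, with $W_0=\varnothing$ and $W_{d+1}=W_d$, let $j\in[0,d]$ be minimal with $D\cap(W_{j+1}\setminus W_j)=\varnothing$. If $U_i$ is a leaf or $j=0$, it halts with $p=i$; otherwise $U_{i+1}=W_j$. At most $\lfloor\frac1c\log_d n\rfloor$ such steps are made. Put $U_{p+1}=\varnothing$. **Preprocessing** (for each path $V=U_1,\dots,U_p$ in the hierarchy tree starting at the root). Let $\mathcal T$ be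 the family of all trees of the covers $\mathcal T_{U_{i+1}}(U_i)$, $1\le i\le p$, where from each tree all vertices of depth $>(2k-1)\rho$ have been deleted. Let $\Lambda$ be the concatenation, in some order, of Euler tours of the trees in $\mathcal T$ (the vertices in the order of first encounter in a depth-first search from the root). Let $\mathcal I$ be a covering set of the positions of $\Lambda$: a set of intervals of positions such that, for some $\kappa$, every interval of positions is a union of at most $\kappa$ members of $\mathcal I$. The directed graph $H$ has the vertices $I_1,I_2$ ($I\in\mathcal I$), $T_1,T_2$ ($T\in\mathcal T$) and $x_1$ ($x\in V$). It has the edges $I_1\to T_1$ and $T_2\to I_2$ whenever some edge of $G$ of weight $\le\rho$ joins a vertex occurring in $I$ to a vertex of $T$, and the edges $T_1\to x_1$ and $x_1\to T_2$ whenever $x\in V(T)$. The table $E'$ consists of all pairs of positions of $\Lambda$, carrying vertices $x$ and $y$, such that $x=y$ or $xy$ is an edge of weight $\le\rho$. **Query** $(u,v,D)$, where $|D|\le d$ and $u,v\in V\setminus D$. Take the path $U_1,\dots,U_p$ found for $D$. A tree $T\in\mathcal T$ is *affected* if $V(T)\cap D\neq\varnothing$. An *affected subtree* is a connected component of $T-D$,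 for an affected $T$, that contains a trunk vertex of $T$. The graph $R$ has the vertices $\{u\}$, $\{v\}$ and all affected subtrees. Each affected subtree $X$ of $T$ is represented by members of $\mathcal I$ whose union is the set of positions of the vertices of $X$ in the tour of $T$, and $\{x\}$ ($x\in\{u,v\}$) is represented by one position of $x$ in $\Lambda$. There is an edge between $X$ and $Y$ in $R$ iff there are intervals $I$ and $J$ in the representations of $X$ and $Y$ such that $J_2$ can be reached from $I_1$ in $H$ without using a copy of an affected tree, or $E'\cap(I\times J)\ne\varnothing$. The algorithm outputs Yes iff $\{u\}$ and $\{v\}$ are connected in $R$. **Theorem.** For every real $c\ge1$ there is a constant $K>0$ such that for all $G,d,\rho$ as above, with $$A=K\cdot d^{c+2}\cdot\frac{\log_2 n}{\log_2 d}\cdot\log_2^5 n$$ (that is, $A=O(d^{c+2}h\log^5 n)$ with $h=\log n/\log d$), the following holds. All choices left open above (tree covers, orders, tours, covering sets, representations) can be made, and however they are made, for all $D\subseteq V$ with $|D|\le d$ and all $u,v\in V\setminus D$: a) if $\delta_{G-D}(u,v)\le\rho$, then the algorithm outputs Yes; b) if the algorithm outputs Yes, then $\delta_{G-D}(u,v)\le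 A\rho$. -/

import Mathlib

namespace VSDO

section Graphs

/-- The length of a walk with respect to the edge weights `w`. -/
def wlen {V : Type*} {H : SimpleGraph V} (w : Sym2 V → ℝ) {u v : V} (p : H.Walk u v) : ℝ :=
  (p.edges.map w).sum

/-- The length `δ_H(u,v)` of a shortest path of `H` from `u` to `v` (`⊤` if there is none). -/
noncomputable def wdist {V : Type*} (H : SimpleGraph V) (w : Sym2 V → ℝ) (u v : V) : EReal :=
  ⨅ p : H.Path u v, ((wlen w (p : H.Walk u v) : ℝ) : EReal)

/-- The graph `G - R`. The deleted vertices stay in the type as isolated vertices. -/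
def del {V : Type*} (G : SimpleGraph V) (R : Finset V) : SimpleGraph V where
  Adj a b := G.Adj a b ∧ a ∉ R ∧ b ∉ R
  symm := ⟨fun _ _ h => ⟨h.1.symm, h.2.2, h.2.1⟩⟩
  loopless := ⟨fun _ h => h.1.ne rfl⟩

/-- The weighted depth of `v` in the tree `T` rooted at `r`. -/
noncomputable def dep {V : Type*} {G : SimpleGraph V} (w : Sym2 V → ℝ) (T : G.Subgraph)
    (r v : V) : EReal :=
  wdist T.spanningCoe w r v

/-- The parameter `k = ln n`. -/
noncomputable def kpar (V : Type*) [Fintype V] : ℝ := Real.log (Fintype.card V)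

end Graphs

section TreeCovers

/-- An `S`-restricted tree cover of `G - R`: one rooted tree `tree x` of `G - R` for each `x ∈ S`
(the values of `tree` outside `S` play no role). -/
structure TreeCover {V : Type*} [Fintype V] (G : SimpleGraph V) (w : Sym2 V → ℝ)
    (R S : Finset V) where
  tree : V → G.Subgraph
  root_mem : ∀ x ∈ S, x ∈ (tree x).verts
  isTree : ∀ x ∈ S, (tree x).coe.IsTree
  avoids : ∀ x ∈ S, ∀ v ∈ (tree x).verts, v ∉ R
  stretch : ∀ u ∈ S, ∀ v, v ∉ R → wdist (del G R) w u v ≠ ⊤ →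
    ∃ x ∈ S, u ∈ (tree x).verts ∧ v ∈ (tree x).verts ∧
      dep w (tree x) x u + dep w (tree x) x v
        ≤ ((2 * kpar V - 1 : ℝ) : EReal) * wdist (del G R) w u v
  overlap : ∀ v : V, (({x : V | x ∈ S ∧ v ∈ (tree x).verts}.ncard : ℕ) : ℝ)
      ≤ kpar V * (Fintype.card V : ℝ) ^ (1 / kpar V) * (Real.log (Fintype.card V) + 1)

/-- The trunk vertices of `T` with respect to the source set `S`: the vertices on the path of `T`
between two vertices of `S` that lie in `T`. -/
def trunk {V : Type*} {G : SimpleGraph V} (T : G.Subgraph) (S : Finset V) : Set V :=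
  {v | ∃ a ∈ S, ∃ b ∈ S, a ∈ T.verts ∧ b ∈ T.verts ∧
    ∃ p : T.spanningCoe.Path a b, v ∈ (p : T.spanningCoe.Walk a b).support}

/-- The pseudo-degree of `v` in `T`: its degree in the trunk (`0` if it is not a trunk vertex). -/
noncomputable def pdeg {V : Type*} {G : SimpleGraph V} (T : G.Subgraph) (S : Finset V) (v : V) :
    ℕ :=
  {x : V | v ∈ trunk T S ∧ x ∈ trunk T S ∧ T.Adj v x}.ncard

/-- The degree threshold `s = 4e·d^{c+1}·ln² n + 1`. -/
noncomputable def threshold (V : Type*) [Fintype V] (c : ℝ) (d : ℕ) : ℝ :=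
  4 * Real.exp 1 * (d : ℝ) ^ (c + 1) * Real.log (Fintype.card V) ^ 2 + 1

open Classical in
/-- The vertices of pseudo-degree more than `s` in some tree of the cover. -/
noncomputable def Hi {V : Type*} [Fintype V] {G : SimpleGraph V} {w : Sym2 V → ℝ}
    {R S : Finset V} (C : TreeCover G w R S) (c : ℝ) (d : ℕ) : Finset V :=
  Finset.univ.filter fun v => ∃ x ∈ S, threshold V c d < (pdeg (C.tree x) S v : ℝ)

/-- A choice of all tree covers `𝒯_R(S)`, that is, of an `(S \ R)`-restricted tree cover of `G - R`
for all `R` and `S`. The cover `𝒯(S)` is `𝒯_∅(S)`. -/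
abbrev Covers {V : Type*} [Fintype V] [DecidableEq V] (G : SimpleGraph V) (w : Sym2 V → ℝ) :=
  (R S : Finset V) → TreeCover G w R (S \ R)

end TreeCovers

section Hierarchy

variable {V : Type*} [Fintype V] [DecidableEq V] {G : SimpleGraph V} {w : Sym2 V → ℝ}

/-- The sets `W₀ = ∅`, `W₁ = Hi(𝒯(U))` and `W_{i+1} = W_i ∪ Hi(𝒯_{W_i}(U))`. -/
noncomputable def Wset (C : Covers G w) (c : ℝ) (d : ℕ) (U : Finset V) : ℕ → Finset V
  | 0 => ∅
  | i + 1 => Wset C c d U i ∪ Hi (C (Wset C c d U i) U) c d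

/-- `U` is a leaf of the hierarchy tree. -/
def IsLeaf (C : Covers G w) (c : ℝ) (d : ℕ) (U : Finset V) : Prop := Hi (C ∅ U) c d = ∅

/-- `U'` is one of the children `W₁, …, W_d` of the node `U` of the hierarchy tree. -/
def IsChild (C : Covers G w) (c : ℝ) (d : ℕ) (U U' : Finset V) : Prop :=
  ¬ IsLeaf C c d U ∧ ∃ j, 1 ≤ j ∧ j ≤ d ∧ U' = Wset C c d U j

/-- `L` is a path of the hierarchy tree that starts at its root `V`. -/
def IsHierarchyPath (C : Covers G w) (c : ℝ) (d : ℕ) (L : List (Finset V)) : Prop :=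
  L.head? = some Finset.univ ∧ L.IsChain (IsChild C c d)

/-- The least `j ∈ [0,d]` with `D ∩ (W_{j+1} \ W_j) = ∅`, where `W_{d+1} = W_d`.
(The index `d` always qualifies.) -/
noncomputable def jIndex (C : Covers G w) (c : ℝ) (d : ℕ) (D U : Finset V) : ℕ :=
  sInf {j | j ≤ d ∧ D ∩ (Wset C c d U (min (j + 1) d) \ Wset C c d U j) = ∅}

open Classical in
/-- The path finding algorithm, from the node `U`, with at most the given number of steps. -/
noncomputable def findPath (C : Covers G w) (c : ℝ) (d : ℕ) (D : Finset V) :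
    ℕ → Finset V → List (Finset V)
  | 0, U => [U]
  | f + 1, U =>
    if IsLeaf C c d U ∨ jIndex C c d D U = 0 then [U]
    else U :: findPath C c d D f (Wset C c d U (jIndex C c d D U))

/-- The bound `⌊(1/c) log_d n⌋` on the number of steps of the path finding algorithm
(it bounds the depth of the hierarchy tree). -/
noncomputable def depthBound (V : Type*) [Fintype V] (c : ℝ) (d : ℕ) : ℕ :=
  ⌊(1 / c) * Real.logb d (Fintype.card V)⌋₊

/-- The path `V = U₁, …, U_p` of the hierarchy tree that the query algorithm uses for `D`. -/
noncomputable def queryPath (C : Covers G w) (c : ℝ) (d : ℕ) (D : Finset V) : List (Finset V) :=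
  findPath C c d D (depthBound V c d) Finset.univ

theorem jIndex_le (C : Covers G w) (c : ℝ) (d : ℕ) (D U : Finset V) :
    jIndex C c d D U ≤ d := by
  have hne : {j | j ≤ d ∧ D ∩ (Wset C c d U (min (j + 1) d) \ Wset C c d U j) = ∅}.Nonempty :=
    ⟨d, le_refl d, by simp⟩
  exact (Nat.sInf_mem hne).1

theorem findPath_spec (C : Covers G w) (c : ℝ) (d : ℕ) (D : Finset V) (f : ℕ) :
    ∀ U, (findPath C c d D f U).head? = some U ∧
      (findPath C c d D f U).IsChain (IsChild C c d) := by
  induction f with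
  | zero => intro U; simp [findPath]
  | succ f ih =>
    intro U
    by_cases h : IsLeaf C c d U ∨ jIndex C c d D U = 0
    · simp [findPath, h]
    · obtain ⟨h1, h2⟩ := ih (Wset C c d U (jIndex C c d D U))
      have hc : IsChild C c d U (Wset C c d U (jIndex C c d D U)) := by
        push Not at h
        exact ⟨h.1, _, Nat.one_le_iff_ne_zero.2 h.2, jIndex_le C c d D U, rfl⟩
      simp only [findPath, h, if_false]
      refine ⟨rfl, ?_⟩
      rw [List.isChain_cons]
      refine ⟨fun y hy => ?_, h2⟩
      rw [h1] at hy
      cases hy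
      exact hc

theorem queryPath_spec (C : Covers G w) (c : ℝ) (d : ℕ) (D : Finset V) :
    IsHierarchyPath C c d (queryPath C c d D) :=
  findPath_spec C c d D _ _

end Hierarchy

section Preprocessing

variable {V : Type*} [Fintype V] [DecidableEq V] {G : SimpleGraph V} {w : Sym2 V → ℝ}

/-- The source set `U_i \ U_{i+1}` of the `i`-th tree cover along `L`. Indices start at `0`, and the
entry after the last one is `∅`. -/
def sources (L : List (Finset V)) (i : ℕ) : Finset V := L.getD i ∅ \ L.getD (i + 1) ∅

/-- The family `𝒯 = ⋃_i 𝒯_{U_{i+1}}(U_i)`: the pair `(i, x)` stands for the tree with root `x` in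
the `i`-th cover. -/
def trees (L : List (Finset V)) : Set (ℕ × V) := {t | t.1 < L.length ∧ t.2 ∈ sources L t.1}

/-- The tree with index `t`, before pruning. -/
def fullTree (C : Covers G w) (L : List (Finset V)) (t : ℕ × V) : G.Subgraph :=
  (C (L.getD (t.1 + 1) ∅) (L.getD t.1 ∅)).tree t.2

/-- The tree with index `t`, after deletion of all vertices of depth more than `(2k-1)ρ`. -/
noncomputable def tree (C : Covers G w) (ρ : ℝ) (L : List (Finset V)) (t : ℕ × V) : G.Subgraph :=
  (fullTree C L t).induce {v | v ∈ (fullTree C L t).verts ∧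
    dep w (fullTree C L t) t.2 v ≤ (((2 * kpar V - 1) * ρ : ℝ) : EReal)}

/-- `DFSForest T p ys l`: a depth-first search of the tree `T` that stands at the vertex `p` and has
to visit its children `ys` in this order records the vertices `l`, in this order. -/
inductive DFSForest {V : Type*} {G : SimpleGraph V} (T : G.Subgraph) :
    V → List V → List V → Prop
  | nil (p : V) : DFSForest T p [] []
  | cons (p y : V) (ys cs l l' : List V) (hnd : cs.Nodup)
      (hcs : ∀ z, z ∈ cs ↔ T.Adj y z ∧ z ≠ p)
      (h : DFSForest T y cs l) (h' : DFSForest T p ys l') :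
      DFSForest T p (y :: ys) (y :: (l ++ l'))

/-- `l` is an Euler tour of the tree `T` rooted at `r`: the vertices in the order in which some
depth-first search from `r` first encounters them. -/
def IsEulerTour {V : Type*} {G : SimpleGraph V} (T : G.Subgraph) (r : V) (l : List V) : Prop :=
  ∃ cs l' : List V, cs.Nodup ∧ (∀ z, z ∈ cs ↔ T.Adj r z) ∧ DFSForest T r cs l' ∧ l = r :: l'

/-- The concatenation `Λ` of the Euler tours of the listed trees. Each entry also carries the index
of the tree that it comes from. -/
def concatTours {V : Type*} (order : List (ℕ × V)) (tour : ℕ × V → List V) :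
    List ((ℕ × V) × V) :=
  order.flatMap fun t => (tour t).map fun v => (t, v)

/-- `𝓘` is a `κ`-covering set of the positions `0, …, N-1`. -/
def IsCoveringSet (κ N : ℕ) (𝓘 : Finset (Finset ℕ)) : Prop :=
  (∀ I ∈ 𝓘, ∃ l r, l ≤ r ∧ r < N ∧ I = Finset.Icc l r) ∧
  ∀ l r, l ≤ r → r < N → ∃ 𝒥 ⊆ 𝓘, 𝒥.card ≤ κ ∧ 𝒥.biUnion id = Finset.Icc l r

/-- The choices made for one path `L` of the hierarchy tree: an order of the trees, their Euler
tours, a covering set of the positions of `Λ`, and the way in which single vertices and sets of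
vertices of a tree are represented by intervals of the covering set. -/
structure PathData (C : Covers G w) (ρ : ℝ) (L : List (Finset V)) where
  order : List (ℕ × V)
  order_nodup : order.Nodup
  mem_order : ∀ t, t ∈ order ↔ t ∈ trees L
  tour : ℕ × V → List V
  isTour : ∀ t ∈ trees L, IsEulerTour (tree C ρ L t) t.2 (tour t)
  κ : ℕ
  𝓘 : Finset (Finset ℕ)
  covering : IsCoveringSet κ (concatTours order tour).length 𝓘
  /-- an occurrence of each vertex in `Λ` -/
  occ : V → ℕ
  occ_spec : ∀ x, ∃ t, (concatTours order tour)[occ x]? = some (t, x)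
  rep : ℕ × V → Set V → Finset (Finset ℕ)
  rep_subset : ∀ t ∈ trees L, ∀ X ⊆ (tree C ρ L t).verts, rep t X ⊆ 𝓘
  rep_union : ∀ t ∈ trees L, ∀ X ⊆ (tree C ρ L t).verts, ∀ q : ℕ,
    (∃ I ∈ rep t X, q ∈ I) ↔ ∃ x ∈ X, (concatTours order tour)[q]? = some (t, x)

/-- The list `Λ`. -/
def PathData.Λ {C : Covers G w} {ρ : ℝ} {L : List (Finset V)} (P : PathData C ρ L) :
    List ((ℕ × V) × V) := concatTours P.order P.tour

/-- The vertex `x` occurs in `Λ` at a position of `I`. -/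
def PathData.Occurs {C : Covers G w} {ρ : ℝ} {L : List (Finset V)} (P : PathData C ρ L)
    (I : Finset ℕ) (x : V) : Prop := ∃ q ∈ I, ∃ t, P.Λ[q]? = some (t, x)

/-- The vertices of the auxiliary graph `H`: two copies of `𝓘`, two copies of `𝒯`, and one copy
of `V`. -/
inductive HNode (V : Type*) where
  | int1 (I : Finset ℕ)
  | tree1 (t : ℕ × V)
  | vert (x : V)
  | tree2 (t : ℕ × V)
  | int2 (I : Finset ℕ)

/-- There is an edge of `G` of weight at most `ρ` from a vertex in `I` to a vertex of the tree
`t`. -/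
def Linked {C : Covers G w} {ρ : ℝ} {L : List (Finset V)} (P : PathData C ρ L) (I : Finset ℕ)
    (t : ℕ × V) : Prop :=
  ∃ x y, P.Occurs I x ∧ y ∈ (tree C ρ L t).verts ∧ G.Adj x y ∧ w s(x, y) ≤ ρ

/-- The directed edges of `H`. -/
inductive HEdge {C : Covers G w} {ρ : ℝ} {L : List (Finset V)} (P : PathData C ρ L) :
    HNode V → HNode V → Prop
  | enter (I : Finset ℕ) (t : ℕ × V) (hI : I ∈ P.𝓘) (ht : t ∈ trees L) (h : Linked P I t) :
      HEdge P (.int1 I) (.tree1 t)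
  | leave (I : Finset ℕ) (t : ℕ × V) (hI : I ∈ P.𝓘) (ht : t ∈ trees L) (h : Linked P I t) :
      HEdge P (.tree2 t) (.int2 I)
  | up (t : ℕ × V) (x : V) (ht : t ∈ trees L) (hx : x ∈ (tree C ρ L t).verts) :
      HEdge P (.tree1 t) (.vert x)
  | down (t : ℕ × V) (x : V) (ht : t ∈ trees L) (hx : x ∈ (tree C ρ L t).verts) :
      HEdge P (.vert x) (.tree2 t)

/-- The table `E'`, a set of pairs of positions of `Λ`. -/
def ETable {C : Covers G w} {ρ : ℝ} {L : List (Finset V)} (P : PathData C ρ L) : Set (ℕ × ℕ) :=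
  {q | ∃ t x t' y, P.Λ[q.1]? = some (t, x) ∧ P.Λ[q.2]? = some (t', y) ∧
    (x = y ∨ (G.Adj x y ∧ w s(x, y) ≤ ρ))}

end Preprocessing

section Query

variable {V : Type*} [Fintype V] [DecidableEq V] {G : SimpleGraph V} {w : Sym2 V → ℝ}

/-- `t` is an affected tree: its pruned tree meets `D`. -/
def IsAffected (C : Covers G w) (ρ : ℝ) (L : List (Finset V)) (D : Finset V) (t : ℕ × V) : Prop :=
  t ∈ trees L ∧ ∃ x ∈ (tree C ρ L t).verts, x ∈ D

/-- `X` is (the vertex set of) an affected subtree of the affected tree `t`: a connected component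
of `T - D` that contains a trunk vertex of `T`. -/
def IsAffectedSubtree (C : Covers G w) (ρ : ℝ) (L : List (Finset V)) (D : Finset V) (t : ℕ × V)
    (X : Set V) : Prop :=
  IsAffected C ρ L D t ∧
  (∃ x ∈ (tree C ρ L t).verts, x ∉ D ∧
    X = {y | ((tree C ρ L t).deleteVerts (D : Set V)).spanningCoe.Reachable x y}) ∧
  ∃ z ∈ X, z ∈ trunk (tree C ρ L t) (sources L t.1)

/-- Reachability in `H - 𝒯*₁ - 𝒯*₂`, where `𝒯*` is the set of affected trees. -/
def ReachesAvoiding {C : Covers G w} {ρ : ℝ} {L : List (Finset V)} (P : PathData C ρ L)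
    (D : Finset V) : HNode V → HNode V → Prop :=
  Relation.ReflTransGen fun a b => HEdge P a b ∧
    ∀ t, IsAffected C ρ L D t → a ≠ .tree1 t ∧ a ≠ .tree2 t ∧ b ≠ .tree1 t ∧ b ≠ .tree2 t

/-- Names for the vertices of the graph `R`: a singleton `{x}`, or a set `X` of vertices of the tree
`t`. -/
inductive RNode (V : Type*) where
  | single (x : V)
  | sub (t : ℕ × V) (X : Set V)

/-- The vertex set of `R`: the singletons `{u}`, `{v}` and the affected subtrees. -/
def IsRVertex (C : Covers G w) (ρ : ℝ) (L : List (Finset V)) (D : Finset V) (u v : V) :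
    RNode V → Prop
  | .single x => x = u ∨ x = v
  | .sub t X => IsAffectedSubtree C ρ L D t X

/-- The intervals of the covering set that represent a vertex of `R`. -/
def PathData.intervals {C : Covers G w} {ρ : ℝ} {L : List (Finset V)} (P : PathData C ρ L) :
    RNode V → Finset (Finset ℕ)
  | .single x => {{P.occ x}}
  | .sub t X => P.rep t X

/-- The graph `R` built by the query algorithm. -/
def RGraph {C : Covers G w} {ρ : ℝ} {L : List (Finset V)} (P : PathData C ρ L) (D : Finset V)
    (u v : V) : SimpleGraph (RNode V) :=
  SimpleGraph.fromRel fun X Y => IsRVertex C ρ L D u v X ∧ IsRVertex C ρ L D u v Y ∧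
    ∃ I ∈ P.intervals X, ∃ J ∈ P.intervals Y,
      ReachesAvoiding P D (.int1 I) (.int2 J) ∨ ∃ q ∈ I, ∃ q' ∈ J, (q, q') ∈ ETable P

/-- A preprocessed oracle for the decision version with parameter `ρ`: all choices that the
preprocessing leaves open. -/
structure Oracle (G : SimpleGraph V) (w : Sym2 V → ℝ) (c : ℝ) (d : ℕ) (ρ : ℝ) where
  cover : Covers G w
  data : ∀ L : List (Finset V), IsHierarchyPath cover c d L → PathData cover ρ L

/-- The query algorithm outputs Yes on the query `(u, v, D)`. -/
def Oracle.OutputsYes {c : ℝ} {d : ℕ} {ρ : ℝ} (O : Oracle G w c d ρ) (u v : V) (D : Finset V) :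
    Prop :=
  (RGraph (O.data (queryPath O.cover c d D) (queryPath_spec O.cover c d D)) D u v).Reachable
    (.single u) (.single v)

end Query

end VSDO

/-! Existence of the oracle reduces to existence of tree covers. `nonempty_treeCover` builds them as
in Thorup and Zwick, with greedy hitting sets in place of random samples: about k = ln n levels,
each smaller than the last by a factor n^(1/k) = e, and a shortest-path tree on each cluster. The
remaining choices are made naively in `nonempty_pathData`.

Completeness (`outputsYes_of_wdist_le`) follows a short path of G - D. Call a vertex marked if it
lies in some vertex of R. Two consecutive marked vertices are handled by the table E'. For a maximal
unmarked stretch, take the last U_i that meets it. The stretch then lies in G - U_{i+1} and contains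
a source x of the i-th cover, so trees of this cover join x to both ends. These trees are
unaffected: otherwise the component of x in T - D would be an affected subtree, and x would be
marked. The two trees and x form a path of H.

Soundness (`wdist_le_of_outputsYes`) multiplies the cost of a step in R, at most 12kρ, by the number
of vertices of R. The count rests on pseudo-degrees. Averaging over forests bounds the number of
high-degree vertices (`card_Hi_mul_le`), so a child in the hierarchy tree is smaller than its parent
by a factor d^c. Hence the step limit suffices, and every vertex of D that survives in G - U_{i+1}
has pseudo-degree at most s (`lowDegreeAlong_queryPath`). In an affected tree, all affected subtrees
but one hang on a trunk edge at a vertex of D. As each vertex lies in few trees, R is small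
(`exists_finset_RVertex`). -/

namespace VSDO

open SimpleGraph

/-! ### Weighted walks and distances. -/

section WeightedDistance

variable {V : Type*} {H : SimpleGraph V} {w : Sym2 V → ℝ}

theorem wlen_append {a b c : V} (p : H.Walk a b) (q : H.Walk b c) :
    wlen w (p.append q) = wlen w p + wlen w q := by
  simp [wlen, Walk.edges_append]

theorem wlen_reverse {a b : V} (p : H.Walk a b) : wlen w p.reverse = wlen w p := by
  simp [wlen, Walk.edges_reverse, List.map_reverse, List.sum_reverse]

theorem wlen_cons {a b c : V} (h : H.Adj a b) (p : H.Walk b c) :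
    wlen w (Walk.cons h p) = w s(a, b) + wlen w p := by
  simp [wlen]

theorem wlen_mapLe {H' : SimpleGraph V} (hle : H ≤ H') {a b : V} (p : H.Walk a b) :
    wlen w (p.mapLe hle) = wlen w p := by
  simp [wlen]

theorem wlen_nonneg (hw : ∀ e ∈ H.edgeSet, 0 < w e) {a b : V} (p : H.Walk a b) :
    0 ≤ wlen w p := by
  refine List.sum_nonneg fun x hx => ?_
  obtain ⟨e, he, rfl⟩ := List.mem_map.1 hx
  exact (hw e (p.edges_subset_edgeSet he)).le

theorem wlen_bypass_le [DecidableEq V] (hw : ∀ e ∈ H.edgeSet, 0 < w e) {a b : V}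
    (p : H.Walk a b) : wlen w p.bypass ≤ wlen w p := by
  refine (p.edges_bypass_sublist_edges.map w).sum_le_sum fun x hx => ?_
  obtain ⟨e, he, rfl⟩ := List.mem_map.1 hx
  exact (hw e (p.edges_subset_edgeSet he)).le

theorem wlen_dropUntil_add_takeUntil [DecidableEq V] {a b z : V} (p : H.Walk a b)
    (hz : z ∈ p.support) : wlen w (p.takeUntil z hz) + wlen w (p.dropUntil z hz) = wlen w p := by
  rw [← wlen_append, Walk.take_spec]

theorem wdist_le_wlen (hw : ∀ e ∈ H.edgeSet, 0 < w e) {a b : V} (p : H.Walk a b) :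
    wdist H w a b ≤ (wlen w p : ℝ) := by
  classical
  refine (iInf_le _ (⟨p.bypass, p.bypass_isPath⟩ : H.Path a b)).trans ?_
  exact_mod_cast wlen_bypass_le hw p

theorem wdist_nonneg (hw : ∀ e ∈ H.edgeSet, 0 < w e) (a b : V) : 0 ≤ wdist H w a b :=
  le_iInf fun p => by exact_mod_cast wlen_nonneg hw (p : H.Walk a b)

theorem wdist_self (hw : ∀ e ∈ H.edgeSet, 0 < w e) (a : V) : wdist H w a a = 0 := by
  refine le_antisymm ?_ (wdist_nonneg hw a a)
  simpa [wlen] using wdist_le_wlen hw (Walk.nil : H.Walk a a)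

theorem wdist_comm (a b : V) : wdist H w a b = wdist H w b a := by
  have key : ∀ a b : V, wdist H w a b ≤ wdist H w b a := fun a b => by
    refine le_iInf fun p => ?_
    refine (iInf_le _ p.reverse).trans (le_of_eq ?_)
    simp [Path.reverse, wlen_reverse]
  exact le_antisymm (key a b) (key b a)

theorem exists_path_of_wdist_ne_top [Finite V] {a b : V} (h : wdist H w a b ≠ ⊤) :
    ∃ p : H.Path a b, wdist H w a b = ((wlen w (p : H.Walk a b) : ℝ) : EReal) := by
  classical
  have := Fintype.ofFinite V
  have hne : Nonempty (H.Path a b) := by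
    by_contra hne
    rw [not_nonempty_iff] at hne
    exact h (iInf_of_empty _)
  obtain ⟨p, hp⟩ := exists_eq_ciInf_of_finite
    (f := fun p : H.Path a b => ((wlen w (p : H.Walk a b) : ℝ) : EReal))
  exact ⟨p, hp.symm⟩

theorem exists_path_of_wdist_le [Finite V] {a b : V} {r : ℝ} (h : wdist H w a b ≤ (r : EReal)) :
    ∃ p : H.Path a b, wdist H w a b = ((wlen w (p : H.Walk a b) : ℝ) : EReal) ∧
      wlen w (p : H.Walk a b) ≤ r := by
  obtain ⟨p, hp⟩ := exists_path_of_wdist_ne_top (ne_top_of_le_ne_top (EReal.coe_ne_top r) h)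
  rw [hp] at h
  exact ⟨p, hp, by exact_mod_cast h⟩

/-- Real upper bounds keep all later sums in ℝ, away from extended-real addition. -/
theorem wdist_triangle_le [Finite V] (hw : ∀ e ∈ H.edgeSet, 0 < w e) {a b c : V} {r t : ℝ}
    (h₁ : wdist H w a b ≤ (r : EReal)) (h₂ : wdist H w b c ≤ (t : EReal)) :
    wdist H w a c ≤ ((r + t : ℝ) : EReal) := by
  obtain ⟨p, -, hp⟩ := exists_path_of_wdist_le h₁
  obtain ⟨q, -, hq⟩ := exists_path_of_wdist_le h₂
  refine (wdist_le_wlen hw ((p : H.Walk a b).append (q : H.Walk b c))).trans ?_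
  rw [wlen_append]
  exact_mod_cast add_le_add hp hq

theorem del_le (G : SimpleGraph V) (R : Finset V) : del G R ≤ G := fun _ _ h => h.1

theorem notMem_of_mem_support_del {G : SimpleGraph V} {R : Finset V} {a b : V}
    (p : (del G R).Walk a b) (ha : a ∉ R) : ∀ z ∈ p.support, z ∉ R := by
  induction p with
  | nil => simpa using ha
  | cons h p ih =>
    intro z hz
    rcases List.mem_cons.1 (by simpa using hz) with rfl | hz
    · exact ha
    · exact ih h.2.2 z hz

theorem pos_of_le {G : SimpleGraph V} (hle : H ≤ G) (hw : ∀ e ∈ G.edgeSet, 0 < w e) :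
    ∀ e ∈ H.edgeSet, 0 < w e :=
  fun e he => hw e (SimpleGraph.edgeSet_mono hle he)

theorem spanningCoe_pos {G : SimpleGraph V} (hw : ∀ e ∈ G.edgeSet, 0 < w e) (T : G.Subgraph) :
    ∀ e ∈ T.spanningCoe.edgeSet, 0 < w e :=
  pos_of_le T.spanningCoe_le hw

end WeightedDistance

/-! ### Subgraphs viewed as graphs on all of V. -/

section TreesAsSpanningGraphs

variable {V : Type*} {G : SimpleGraph V}

theorem isAcyclic_spanningCoe {T : G.Subgraph} (h : T.coe.IsAcyclic) :
    T.spanningCoe.IsAcyclic := by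
  intro a c hc
  have hv : ∀ z ∈ c.support, z ∈ T.verts := by
    intro z hz
    obtain ⟨e, he, hze⟩ := (Walk.mem_support_iff_exists_mem_edges_of_not_nil hc.not_nil).1 hz
    have := c.edges_subset_edgeSet he
    induction e with
    | _ x y =>
      rcases Sym2.mem_iff.1 hze with rfl | rfl
      · exact T.edge_vert this
      · exact T.edge_vert (T.symm.symm _ _ this)
  rw [← Walk.map_induce c hv] at hc
  exact h _ hc.of_map

theorem mem_verts_of_mem_support {T : G.Subgraph} {a b : V} (p : T.spanningCoe.Walk a b)
    (ha : a ∈ T.verts) : ∀ z ∈ p.support, z ∈ T.verts := by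
  induction p with
  | nil => simpa using ha
  | cons h p ih =>
    intro z hz
    rcases List.mem_cons.1 (by simpa using hz) with rfl | hz
    · exact ha
    · exact ih (T.edge_vert (T.symm.symm _ _ h)) z hz

end TreesAsSpanningGraphs

/-! ### Greedy hitting sets and the derandomized sampling hierarchy. -/

section HittingSets

variable {V : Type*} [DecidableEq V]

/-- Averaging: double count the pairs (x, v) with x ∈ F v. -/
theorem exists_mem_many (A : Finset V) (q : ℝ) (hA : A.Nonempty) (F : V → Finset V)
    (hF : ∀ v, F v ⊆ A) (I : Finset V) (hI : ∀ v ∈ I, q ≤ ((F v).card : ℝ)) :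
    ∃ x ∈ A, (I.card : ℝ) * q / A.card ≤ ((I.filter fun v => x ∈ F v).card : ℝ) := by
  by_contra! hcon
  have h1 : ∑ x ∈ A, ((I.filter fun v => x ∈ F v).card : ℝ) = ∑ v ∈ I, ((F v).card : ℝ) := by
    simp only [Finset.card_filter, Nat.cast_sum]
    rw [Finset.sum_comm]
    refine Finset.sum_congr rfl fun v _ => ?_
    have : F v = A.filter (· ∈ F v) := by
      ext x; simp only [Finset.mem_filter]; exact ⟨fun h => ⟨hF v h, h⟩, fun h => h.2⟩
    conv_rhs => rw [this, Finset.card_filter]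
    push_cast
    rfl
  have h2 : (I.card : ℝ) * q ≤ ∑ v ∈ I, ((F v).card : ℝ) := by
    rw [← nsmul_eq_mul]
    exact Finset.card_nsmul_le_sum _ _ _ hI
  have h3 : ∑ x ∈ A, ((I.filter fun v => x ∈ F v).card : ℝ)
      < ∑ _x ∈ A, (I.card : ℝ) * q / A.card := Finset.sum_lt_sum_of_nonempty hA hcon
  rw [Finset.sum_const, nsmul_eq_mul, h1] at h3
  have hA' : (A.card : ℝ) ≠ 0 := by simpa [Finset.card_eq_zero] using hA.ne_empty
  rw [mul_div_cancel₀ _ hA'] at h3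
  linarith

variable [Fintype V]

/-- Adding the most popular element leaves at most the fraction 1 - q/|A| of the sets that were not
yet hit. -/
theorem exists_greedy (A : Finset V) (q : ℝ) (hqA : q ≤ A.card) (hA : A.Nonempty)
    (F : V → Finset V) (hF : ∀ v, F v ⊆ A) (hFq : ∀ v, q ≤ ((F v).card : ℝ)) (m : ℕ) :
    ∃ H ⊆ A, H.card ≤ m ∧
      (((Finset.univ.filter fun v => Disjoint H (F v)).card : ℕ) : ℝ)
        ≤ Fintype.card V * (1 - q / A.card) ^ m := by
  have hApos : (0 : ℝ) < A.card := by exact_mod_cast hA.card_pos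
  induction m with
  | zero => exact ⟨∅, by simp, by simp, by simp⟩
  | succ m ih =>
    obtain ⟨H, hHA, hHm, hu⟩ := ih
    set I := Finset.univ.filter fun v => Disjoint H (F v) with hI
    obtain ⟨x, hxA, hx⟩ := exists_mem_many A q hA F hF I fun v _ => hFq v
    refine ⟨insert x H, Finset.insert_subset hxA hHA, (Finset.card_insert_le _ _).trans (by omega),
      ?_⟩
    have h1 : (Finset.univ.filter fun v => Disjoint (insert x H) (F v))
        = I.filter fun v => ¬ x ∈ F v := by
      ext v; simp [hI, Finset.disjoint_insert_left, and_comm]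
    have h2 := Finset.card_filter_add_card_filter_not (s := I) (fun v => x ∈ F v)
    have h3 : (((I.filter fun v => x ∈ F v).card : ℕ) : ℝ)
      + ((I.filter fun v => ¬ x ∈ F v).card : ℕ) = I.card := by exact_mod_cast h2
    have hnn : 0 ≤ 1 - q / A.card := by
      rw [sub_nonneg, div_le_one hApos]; exact hqA
    rw [h1, pow_succ, ← mul_assoc]
    calc _ ≤ (I.card : ℝ) * (1 - q / A.card) := by
            have : (I.card : ℝ) * (1 - q / A.card) = I.card - I.card * q / A.card := by ring
            rw [this]; linarith
      _ ≤ _ := mul_le_mul_of_nonneg_right hu hnn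

/-- After ⌈(|A|/q) ln n⌉ greedy rounds fewer than n · e^(-ln n) = 1 sets are left, hence none. -/
theorem exists_hittingSet (A : Finset V) (q : ℝ) (hq : 0 < q) (hqA : q ≤ A.card)
    (hn : 2 ≤ Fintype.card V)
    (F : V → Finset V) (hF : ∀ v, F v ⊆ A) (hFq : ∀ v, q ≤ ((F v).card : ℝ)) :
    ∃ H ⊆ A, (H.card : ℝ) ≤ A.card / q * (Real.log (Fintype.card V) + 1) ∧
      ∀ v, ∃ x ∈ H, x ∈ F v := by
  have hApos : (0 : ℝ) < A.card := hq.trans_le hqA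
  have hA : A.Nonempty := Finset.card_pos.1 (by exact_mod_cast hApos)
  have hnpos : (0 : ℝ) < Fintype.card V := by exact_mod_cast (by omega : 0 < Fintype.card V)
  have hlog : 0 < Real.log (Fintype.card V) :=
    Real.log_pos (by exact_mod_cast (by omega : 1 < Fintype.card V))
  set a : ℝ := (A.card : ℝ)
  set l := Real.log (Fintype.card V)
  have haq : 1 ≤ a / q := (one_le_div hq).2 hqA
  obtain ⟨H, hHA, hHm, hu⟩ := exists_greedy A q hqA hA F hF hFq ⌈a / q * l⌉₊
  refine ⟨H, hHA, ?_, ?_⟩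
  · have h1 : (H.card : ℝ) ≤ (⌈a / q * l⌉₊ : ℝ) := by exact_mod_cast hHm
    have h2 := (Nat.ceil_lt_add_one (by positivity : 0 ≤ a / q * l)).le
    linarith
  · have hx : 0 < q / a := by positivity
    have hlt : (Fintype.card V : ℝ) * (1 - q / a) ^ ⌈a / q * l⌉₊ < 1 := by
      have h1 : (1 - q / a) < Real.exp (-(q / a)) := by
        have := Real.add_one_lt_exp (x := -(q / a)) (by linarith)
        linarith
      -- The strict inequality 1 - x < e^(-x) survives taking powers only for a nonzero exponent.
      have hm0 : ⌈a / q * l⌉₊ ≠ 0 := by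
        have : 0 < a / q * l := by positivity
        have := Nat.ceil_pos.2 this
        omega
      have h0 : 0 ≤ 1 - q / a := by rw [sub_nonneg, div_le_one hApos]; exact hqA
      have h2 : (1 - q / a) ^ ⌈a / q * l⌉₊ < Real.exp (-(q / a)) ^ ⌈a / q * l⌉₊ :=
        pow_lt_pow_left₀ h1 h0 hm0
      rw [← Real.exp_nat_mul] at h2
      have h3 : (⌈a / q * l⌉₊ : ℝ) * -(q / a) ≤ - l := by
        have h4 := Nat.le_ceil (a / q * l)
        have h5 : a / q * l * (q / a) = l := by field_simp
        have := mul_le_mul_of_nonneg_right h4 hx.le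
        linarith
      have h4 : Real.exp (-l) = (Fintype.card V : ℝ)⁻¹ := by
        rw [Real.exp_neg, Real.exp_log hnpos]
      calc (Fintype.card V : ℝ) * (1 - q / a) ^ ⌈a / q * l⌉₊
          < Fintype.card V * Real.exp (-l) :=
            mul_lt_mul_of_pos_left (h2.trans_le (Real.exp_le_exp.2 h3)) hnpos
        _ = 1 := by rw [h4, mul_inv_cancel₀ hnpos.ne']
    have h0 : (Finset.univ.filter fun v => Disjoint H (F v)).card = 0 := by
      have : (((Finset.univ.filter fun v => Disjoint H (F v)).card : ℕ) : ℝ) < 1 :=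
        hu.trans_lt hlt
      exact_mod_cast Nat.lt_one_iff.1 (by exact_mod_cast this)
    intro v
    rw [Finset.card_eq_zero, Finset.filter_eq_empty_iff] at h0
    have := h0 (Finset.mem_univ v)
    rw [Finset.not_disjoint_iff] at this
    exact this

/-- Thinning out a set so that few elements are strictly closer than the remaining ones. -/
theorem exists_thinning {α : Type*} [LinearOrder α] (hn : 2 ≤ Fintype.card V) (δ : V → V → α)
    (A : Finset V) :
    ∃ B ⊆ A, (B.card : ℝ) * Real.exp 1 ≤ A.card ∧
      ∀ v, (((A.filter fun x => ∀ h ∈ B, δ x v < δ h v).card : ℕ) : ℝ)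
        ≤ Real.exp 1 * (Real.log (Fintype.card V) + 1) := by
  have hlog : 0 < Real.log (Fintype.card V) :=
    Real.log_pos (by exact_mod_cast (by omega : 1 < Fintype.card V))
  set q := Real.exp 1 * (Real.log (Fintype.card V) + 1) with hqdef
  have hq : 0 < q := by positivity
  by_cases hqA : q ≤ A.card
  swap
  · refine ⟨∅, by simp, by simp, fun v => ?_⟩
    push Not at hqA
    refine le_trans ?_ hqA.le
    exact_mod_cast Finset.card_filter_le _ _
  have hA : A.Nonempty := Finset.card_pos.1 (by exact_mod_cast hq.trans_le hqA)
  let ball : V → V → Finset V := fun v y => A.filter fun x => δ x v ≤ δ y v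
  -- For each v, y is the centre-distance of the smallest closed ball around v with at least q
  -- elements of A. The set B will hit all these balls.
  have hy : ∀ v, ∃ y ∈ A, q ≤ ((ball v y).card : ℝ) ∧
      ∀ z ∈ A, δ z v < δ y v → ((ball v z).card : ℝ) < q := by
    intro v
    obtain ⟨y₀, hy₀, hmax⟩ := A.exists_max_image (fun x => δ x v) hA
    have hne : (A.filter fun y => q ≤ ((ball v y).card : ℝ)).Nonempty := by
      refine ⟨y₀, Finset.mem_filter.2 ⟨hy₀, ?_⟩⟩
      have : ball v y₀ = A := Finset.filter_true_of_mem hmax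
      rw [this]; exact hqA
    obtain ⟨y, hy, hmin⟩ := Finset.exists_min_image _ (fun x => δ x v) hne
    rw [Finset.mem_filter] at hy
    refine ⟨y, hy.1, hy.2, fun z hz hlt => ?_⟩
    by_contra! hcon
    exact absurd (hmin z (Finset.mem_filter.2 ⟨hz, hcon⟩)) (not_le.2 hlt)
  choose y hyA hyq hymin using hy
  obtain ⟨B, hBA, hBcard, hB⟩ := exists_hittingSet A q hq hqA hn (fun v => ball v (y v))
    (fun v => Finset.filter_subset _ _) hyq
  refine ⟨B, hBA, ?_, fun v => ?_⟩
  · have h1 : (A.card : ℝ) / q * (Real.log (Fintype.card V) + 1) * Real.exp 1 = A.card := by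
      rw [hqdef]; field_simp
    rw [← h1]
    exact mul_le_mul_of_nonneg_right hBcard (Real.exp_pos 1).le
  · obtain ⟨h, hh, hhy⟩ := hB v
    have hhy' := (Finset.mem_filter.1 hhy).2
    rcases (A.filter fun x => ∀ h ∈ B, δ x v < δ h v).eq_empty_or_nonempty with he | hne
    · rw [he]; simpa using hq.le
    -- The farthest element z that beats all of B is closer than y v, so its ball has fewer than q
    -- elements; it contains all the elements to be counted.
    · obtain ⟨z, hz, hmax⟩ := Finset.exists_max_image _ (fun x => δ x v) hne
      obtain ⟨hzA, hzB⟩ := Finset.mem_filter.1 hz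
      refine le_trans ?_ (hymin v z hzA ((hzB h hh).trans_le hhy')).le
      exact_mod_cast Finset.card_le_card fun x hx =>
        Finset.mem_filter.2 ⟨(Finset.mem_filter.1 hx).1, hmax x hx⟩

/-- The sampling hierarchy of Thorup and Zwick. -/
theorem exists_sampling_hierarchy {α : Type*} [LinearOrder α] (hn : 2 ≤ Fintype.card V)
    (δ : V → V → α) (S : Finset V) :
    ∃ A : ℕ → Finset V, A 0 = S ∧ (∀ i, A (i + 1) ⊆ A i) ∧
      (∀ i, ((A i).card : ℝ) * Real.exp 1 ^ i ≤ Fintype.card V) ∧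
      ∀ i v, ((((A i).filter fun x => ∀ h ∈ A (i + 1), δ x v < δ h v).card : ℕ) : ℝ)
        ≤ Real.exp 1 * (Real.log (Fintype.card V) + 1) := by
  choose B hBA hBc hB using fun A : Finset V => exists_thinning hn δ A
  refine ⟨fun i => B^[i] S, rfl, fun i => ?_, fun i => ?_, fun i v => ?_⟩
  · simp only [Function.iterate_succ_apply']; exact hBA _
  · induction i with
    | zero => simpa using (by exact_mod_cast Finset.card_le_univ S)
    | succ i ih =>
      simp only [Function.iterate_succ_apply']
      refine le_trans ?_ ih
      rw [pow_succ', ← mul_assoc]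
      exact mul_le_mul_of_nonneg_right (hBc _) (by positivity)
  · simp only [Function.iterate_succ_apply']; exact hB _ v

end HittingSets

/-! ### Trees from parent pointers. -/

section ShortestPathTrees

variable {V : Type*} {G : SimpleGraph V} {w : Sym2 V → ℝ}

theorem wdist_pos [Finite V] (hw : ∀ e ∈ G.edgeSet, 0 < w e) {a b : V} (hab : a ≠ b) :
    0 < wdist G w a b := by
  by_contra! hcon
  obtain ⟨⟨p, _⟩, -, hp⟩ := exists_path_of_wdist_le (r := 0) (by simpa using hcon)
  cases p with
  | nil => exact hab rfl
  | @cons _ z _ h q =>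
    simp only [wlen_cons] at hp
    have := hw s(a, z) h
    have := wlen_nonneg hw q
    linarith

theorem wellFounded_of_potential [Finite V] (D : V → ℝ) : WellFounded fun a b => D a < D b := by
  have : IsTrans V fun a b => D a < D b := ⟨fun _ _ _ => lt_trans⟩
  have : Std.Irrefl fun a b : V => D a < D b := ⟨fun _ => lt_irrefl _⟩
  exact Finite.wellFounded_of_trans_of_irrefl _

/-- The subgraph formed by the edges from the vertices of `C` to their parents. -/
def parentTree (C : Set V) (r : V) (par : V → V)
    (hpar : ∀ v ∈ C, v ≠ r → par v ∈ C ∧ G.Adj (par v) v) : G.Subgraph where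
  verts := C
  Adj a b := (a ∈ C ∧ a ≠ r ∧ par a = b) ∨ (b ∈ C ∧ b ≠ r ∧ par b = a)
  adj_sub := by
    rintro a b (⟨h1, h2, rfl⟩ | ⟨h1, h2, rfl⟩)
    · exact (hpar _ h1 h2).2.symm
    · exact (hpar _ h1 h2).2
  edge_vert := by
    rintro a b (⟨h1, h2, rfl⟩ | ⟨h1, h2, rfl⟩)
    · exact h1
    · exact (hpar _ h1 h2).1
  symm := ⟨fun _ _ h => h.symm⟩

/-- The potential D drops strictly from a vertex to its parent, so parent pointers lead to r, and
telescoping the drops bounds the length of the walk. -/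
theorem exists_shortestPathTree [Finite V] (hw : ∀ e ∈ G.edgeSet, 0 < w e) (C : Set V) (r : V)
    (hr : r ∈ C) (D : V → ℝ) (hD : D r = 0)
    (hpar : ∀ v ∈ C, v ≠ r → ∃ z ∈ C, G.Adj z v ∧ D z + w s(z, v) ≤ D v) :
    ∃ T : G.Subgraph, T.verts = C ∧ T.coe.IsTree ∧
      ∀ v ∈ C, ∃ p : T.spanningCoe.Walk r v, wlen w p ≤ D v := by
  choose! par hparC hparAdj hparD using hpar
  set T := parentTree (G := G) C r par (fun v h1 h2 => ⟨hparC v h1 h2, hparAdj v h1 h2⟩) with hT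
  have hlt : ∀ v ∈ C, v ≠ r → D (par v) < D v := fun v h1 h2 => by
    have := hw s(par v, v) (hparAdj v h1 h2)
    have := hparD v h1 h2
    linarith
  have hadj : ∀ v ∈ C, v ≠ r → T.Adj (par v) v := fun v h1 h2 => Or.inr ⟨h1, h2, rfl⟩
  refine ⟨T, rfl, ?_, ?_⟩
  · have hreach : ∀ v (hv : v ∈ C), T.coe.Reachable ⟨r, hr⟩ ⟨v, hv⟩ := by
      intro v
      induction v using (wellFounded_of_potential D).induction with
      | _ v ih =>
        intro hv
        rcases eq_or_ne v r with rfl | hne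
        · exact Reachable.refl _
        · have h1 := ih _ (hlt v hv hne) (hparC v hv hne)
          refine h1.trans (Adj.reachable ?_)
          exact hadj v hv hne
    have hconn : T.coe.Connected := by
      have : Nonempty T.verts := ⟨⟨r, hr⟩⟩
      exact ⟨fun a b => (hreach a a.2).symm.trans (hreach b b.2)⟩
    rw [isTree_iff_connected_and_card]
    refine ⟨hconn, le_antisymm ?_ hconn.card_vert_le_card_edgeSet_add_one⟩
    -- Every edge joins some non-root vertex to its parent, so there are fewer edges than vertices;
    -- with connectedness this gives a tree.
    let f : {v : T.verts // v ≠ ⟨r, hr⟩} → T.coe.edgeSet := fun v =>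
      ⟨s(⟨par v.1, hparC v.1 v.1.2 fun h => v.2 (Subtype.ext h)⟩, v.1),
        hadj v.1 v.1.2 fun h => v.2 (Subtype.ext h)⟩
    have hf : Function.Surjective f := by
      rintro ⟨e, he⟩
      induction e with
      | _ a b =>
        rcases (he : (a.1 ∈ C ∧ a.1 ≠ r ∧ par a = b) ∨ (b.1 ∈ C ∧ b.1 ≠ r ∧ par b = a)) with
          h | h
        · refine ⟨⟨a, fun h' => h.2.1 (congrArg Subtype.val h')⟩, Subtype.ext ?_⟩
          exact Sym2.eq_swap.trans (congrArg (fun z => s(a, z)) (Subtype.ext h.2.2))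
        · refine ⟨⟨b, fun h' => h.2.1 (congrArg Subtype.val h')⟩, Subtype.ext ?_⟩
          exact congrArg (fun z => s(z, b)) (Subtype.ext h.2.2)
    have h1 := Nat.card_le_card_of_surjective f hf
    have h2 : Nat.card {v : T.verts // v ≠ ⟨r, hr⟩} < Nat.card T.verts :=
      Finite.card_subtype_lt (x := ⟨r, hr⟩) (by simp)
    omega
  · intro v
    induction v using (wellFounded_of_potential D).induction with
    | _ v ih =>
      intro hv
      rcases eq_or_ne v r with rfl | hne
      · exact ⟨Walk.nil, by simp [wlen, hD]⟩
      · obtain ⟨p, hp⟩ := ih _ (hlt v hv hne) (hparC v hv hne)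
        have ha : T.spanningCoe.Adj (par v) v := hadj v hv hne
        refine ⟨p.append (Walk.cons ha Walk.nil), ?_⟩
        rw [wlen_append, wlen_cons]
        have := hparD v hv hne
        simp only [wlen, Walk.edges_nil, List.map_nil, List.sum_nil] at hp ⊢
        linarith

end ShortestPathTrees

/-! ### Levels of the sampling hierarchy. -/

section SamplingLevels

variable {V : Type*}

/-- `A` is a decreasing hierarchy of sets that starts at `S` and is exhausted at the level `N`. -/
structure SamplingLevels (S : Finset V) (N : ℕ) (A : ℕ → Finset V) : Prop where
  zero : A 0 = S
  anti : ∀ i, A (i + 1) ⊆ A i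
  last : A N = ∅

theorem SamplingLevels.exists_level {S : Finset V} {N : ℕ} {A : ℕ → Finset V}
    (hA : SamplingLevels S N A) {x : V} (hx : x ∈ S) : ∃ i, x ∈ A i ∧ x ∉ A (i + 1) := by
  by_contra! hcon
  have : ∀ i, x ∈ A i := fun i => by
    induction i with
    | zero => rw [hA.zero]; exact hx
    | succ i ih => exact hcon i ih
  have := this N
  rw [hA.last] at this
  simp at this

theorem SamplingLevels.level_unique {S : Finset V} {N : ℕ} {A : ℕ → Finset V}
    (hA : SamplingLevels S N A) {x : V} {i j : ℕ} (hi : x ∈ A i) (hi' : x ∉ A (i + 1))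
    (hj : x ∈ A j) (hj' : x ∉ A (j + 1)) : i = j := by
  have hanti : Antitone A := antitone_nat_of_succ_le hA.anti
  rcases lt_trichotomy i j with h | h | h
  · exact absurd (hanti (Nat.succ_le_of_lt h) hj) hi'
  · exact h
  · exact absurd (hanti (Nat.succ_le_of_lt h) hi) hj'

end SamplingLevels

/-! ### Existence of tree covers. -/

section TreeCoverExistence

variable {V : Type*} [Fintype V]

/-- ln 3 = 1 + ln(3/e) ≥ 2 - e/3. The margin above 1 is needed in `two_le_threshold`. -/
theorem one_lt_kpar (hn : 3 ≤ Fintype.card V) : 1.09 ≤ kpar V := by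
  have h3 : (3 : ℝ) ≤ Fintype.card V := by exact_mod_cast hn
  have h1 : Real.log 3 ≤ kpar V := Real.log_le_log (by norm_num) h3
  have h2 := Real.one_sub_inv_le_log_of_pos (x := 3 / Real.exp 1) (by positivity)
  rw [Real.log_div (by norm_num) (Real.exp_pos 1).ne', Real.log_exp, inv_div] at h2
  have := Real.exp_one_lt_d9
  linarith

theorem card_rpow_inv_kpar (hn : 3 ≤ Fintype.card V) :
    (Fintype.card V : ℝ) ^ (1 / kpar V) = Real.exp 1 := by
  have h3 : (0 : ℝ) < Fintype.card V := by exact_mod_cast (by omega : 0 < Fintype.card V)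
  have := one_lt_kpar hn
  rw [Real.rpow_def_of_pos h3]
  congr 1
  change kpar V * (1 / kpar V) = 1
  exact mul_one_div_cancel (by linarith)

/-- Here m + 1 = ⌊k⌋. Each of the levels 0, …, m - 1 contributes at most e(k + 1) trees at a vertex;
the top level contributes at most its whole size, e^(k-m). -/
theorem overlap_sum_le {k : ℝ} {m : ℕ} (h₁ : (m : ℝ) + 1 ≤ k) (h₂ : k < m + 2) :
    m * (Real.exp 1 * (k + 1)) + Real.exp (k - m) ≤ k * Real.exp 1 * (k + 1) := by
  obtain ⟨f, rfl⟩ : ∃ f, k = m + 1 + f := ⟨k - m - 1, by ring⟩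
  have hf0 : 0 ≤ f := by linarith
  have hf1 : f < 1 := by linarith
  have hm : (0 : ℝ) ≤ m := m.cast_nonneg
  have h3 : Real.exp f ≤ 1 + f + f ^ 2 := by
    have := Real.abs_exp_sub_one_sub_id_le (x := f) (by rw [abs_of_nonneg hf0]; exact hf1.le)
    have := (abs_le.1 this).2
    linarith
  have h4 : Real.exp (m + 1 + f - m) = Real.exp 1 * Real.exp f := by
    rw [← Real.exp_add]; congr 1; ring
  rw [h4]
  have h5 : Real.exp f ≤ (1 + f) * (m + 1 + f + 1) := by nlinarith [mul_nonneg hf0 hm]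
  have := mul_le_mul_of_nonneg_left h5 (Real.exp_pos 1).le
  nlinarith

variable {G : SimpleGraph V} {w : Sym2 V → ℝ}

/-- The cluster of `x` at the level `i`. -/
def cluster (H : SimpleGraph V) (w : Sym2 V → ℝ) (A : ℕ → Finset V) (i : ℕ) (x : V) : Set V :=
  {v | wdist H w x v ≠ ⊤ ∧ ∀ h ∈ A (i + 1), wdist H w x v < wdist H w h v}

/-- Clusters are closed under predecessors on shortest paths from x: if some h of the next level
were at least as close to the predecessor z as x is, it would also be at least as close to v. -/
theorem exists_cluster_tree {H : SimpleGraph V} (hle : H ≤ G) (hw : ∀ e ∈ G.edgeSet, 0 < w e)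
    (A : ℕ → Finset V) {i : ℕ} {x : V} (hx : x ∉ A (i + 1)) :
    ∃ T : G.Subgraph, T.verts = cluster H w A i x ∧ T.coe.IsTree ∧
      ∀ v ∈ cluster H w A i x, dep w T x v ≤ wdist H w x v := by
  have hwH := pos_of_le hle hw
  have hcoe : ∀ v ∈ cluster H w A i x,
      (((wdist H w x v).toReal : ℝ) : EReal) = wdist H w x v := fun v hv =>
    EReal.coe_toReal hv.1 (ne_bot_of_le_ne_bot (by simp) (wdist_nonneg hwH x v))
  obtain ⟨T, hT, htree, hwalk⟩ := exists_shortestPathTree hw (cluster H w A i x) x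
    ⟨by simp [wdist_self hwH], fun h hh => by
      rw [wdist_self hwH]
      exact wdist_pos hwH (by rintro rfl; exact hx hh)⟩
    (fun v => (wdist H w x v).toReal) (by simp [wdist_self hwH]) (by
      intro v hv hne
      obtain ⟨⟨p, _⟩, hp⟩ := exists_path_of_wdist_ne_top hv.1
      have hrev : wlen w p = wlen w p.reverse := (wlen_reverse p).symm
      rw [hrev] at hp
      -- Reversing the path exposes the predecessor of v as its second vertex.
      generalize p.reverse = q at hp
      cases q with
      | nil => exact absurd rfl hne
      | @cons _ z _ h q =>
        rw [wlen_cons] at hp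
        have hz : wdist H w x z ≤ (wlen w q : ℝ) := by
          have := wdist_le_wlen hwH q.reverse
          rwa [wlen_reverse] at this
        have hvz : wdist H w z v ≤ (w s(v, z) : ℝ) := by
          have := wdist_le_wlen hwH (Walk.cons h.symm Walk.nil)
          simpa [wlen, Sym2.eq_swap] using this
        have hzC : z ∈ cluster H w A i x := by
          refine ⟨ne_top_of_le_ne_top (EReal.coe_ne_top _) hz, fun y hy => hz.trans_lt ?_⟩
          by_contra! hcon
          have h1 := wdist_triangle_le hwH hcon hvz
          have h2 := hv.2 y hy
          rw [hp, add_comm] at h2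
          exact absurd h1 (not_le.2 h2)
        refine ⟨z, hzC, hle h.symm, ?_⟩
        have h1 := hcoe z hzC
        rw [← h1] at hz
        have hz' : (wdist H w x z).toReal ≤ wlen w q := by exact_mod_cast hz
        simp only [hp, EReal.toReal_coe, Sym2.eq_swap (a := z)]
        linarith)
  refine ⟨T, hT, htree, fun v hv => ?_⟩
  obtain ⟨p, hp⟩ := hwalk v hv
  refine (wdist_le_wlen (spanningCoe_pos hw T) p).trans ?_
  rw [← hcoe v hv]
  exact_mod_cast hp

/-- The Thorup–Zwick query: climb the levels, exchanging the roles of u and v whenever the current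
centre fails to contain the other endpoint. At level i some centre has distance at most i·r to the
active endpoint. -/
theorem exists_common_cluster {H : SimpleGraph V} (hw : ∀ e ∈ H.edgeSet, 0 < w e)
    {S : Finset V} {N : ℕ} {A : ℕ → Finset V} (hA : SamplingLevels S N A)
    {u v : V} {r : ℝ} (hr : 0 ≤ r) (huv : wdist H w u v ≤ (r : EReal)) (hu : u ∈ S) :
    ∃ i a, i < N ∧ a ∈ A i ∧ a ∉ A (i + 1) ∧ u ∈ cluster H w A i a ∧ v ∈ cluster H w A i a ∧
      ∃ s t : ℝ, wdist H w a u ≤ (s : EReal) ∧ wdist H w a v ≤ (t : EReal) ∧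
        s + t ≤ (2 * i + 1) * r := by
  have hanti : Antitone A := antitone_nat_of_succ_le hA.anti
  have main : ∀ j i : ℕ, i + j = N → ∀ x y : V, (x = u ∧ y = v) ∨ (x = v ∧ y = u) →
      (∃ a ∈ A i, wdist H w a x ≤ ((i * r : ℝ) : EReal)) →
      ∃ i a, i < N ∧ a ∈ A i ∧ a ∉ A (i + 1) ∧ x ∈ cluster H w A i a ∧ y ∈ cluster H w A i a ∧
      ∃ s t : ℝ, wdist H w a x ≤ (s : EReal) ∧ wdist H w a y ≤ (t : EReal) ∧
        s + t ≤ (2 * i + 1) * r := by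
    intro j
    induction j with
    | zero =>
      rintro i hi x y - ⟨a, ha, -⟩
      rw [add_zero] at hi
      rw [hi, hA.last] at ha
      simp at ha
    | succ j ih =>
      rintro i hi x y hxy ⟨a₀, ha₀, hle₀⟩
      obtain ⟨a, ha, hmin⟩ := (A i).exists_min_image (fun a => wdist H w a x) ⟨a₀, ha₀⟩
      have hax : wdist H w a x ≤ ((i * r : ℝ) : EReal) := (hmin a₀ ha₀).trans hle₀
      have hswap : ∀ i a, (i < N ∧ a ∈ A i ∧ a ∉ A (i + 1) ∧ y ∈ cluster H w A i a ∧
          x ∈ cluster H w A i a ∧ ∃ s t : ℝ, wdist H w a y ≤ (s : EReal) ∧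
          wdist H w a x ≤ (t : EReal) ∧ s + t ≤ (2 * i + 1) * r) →
          (i < N ∧ a ∈ A i ∧ a ∉ A (i + 1) ∧ x ∈ cluster H w A i a ∧
          y ∈ cluster H w A i a ∧ ∃ s t : ℝ, wdist H w a x ≤ (s : EReal) ∧
          wdist H w a y ≤ (t : EReal) ∧ s + t ≤ (2 * i + 1) * r) := by
        rintro i a ⟨h1, h2, h3, h4, h5, s, t, h6, h7, h8⟩
        exact ⟨h1, h2, h3, h5, h4, t, s, h7, h6, by linarith⟩
      have hstep : ((i * r : ℝ) : EReal) ≤ (((i + 1 : ℕ) * r : ℝ) : EReal) := by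
        rw [EReal.coe_le_coe_iff]
        exact mul_le_mul_of_nonneg_right (by push_cast; linarith) hr
      -- Clusters require strict inequality, so a next-level vertex that is equally close excludes x
      -- itself; then the level rises without an exchange.
      by_cases hnear : ∃ h ∈ A (i + 1), wdist H w h x ≤ wdist H w a x
      · obtain ⟨h, hh, hhx⟩ := hnear
        exact ih (i + 1) (by omega) x y hxy ⟨h, hh, (hhx.trans hax).trans hstep⟩
      push Not at hnear
      have hxy' : wdist H w x y ≤ (r : EReal) := by
        rcases hxy with ⟨rfl, rfl⟩ | ⟨rfl, rfl⟩
        · exact huv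
        · rw [wdist_comm]; exact huv
      have hay := wdist_triangle_le hw hax hxy'
      have hay' : wdist H w a y ≤ (((i + 1 : ℕ) * r : ℝ) : EReal) := by
        convert hay using 2; push_cast; ring
      have hxC : x ∈ cluster H w A i a :=
        ⟨ne_top_of_le_ne_top (EReal.coe_ne_top _) hax, hnear⟩
      by_cases hyC : y ∈ cluster H w A i a
      · refine ⟨i, a, by omega, ha, fun h => lt_irrefl _ (hnear a h), hxC, hyC, i * r,
          (i + 1 : ℕ) * r, hax, hay', le_of_eq ?_⟩
        push_cast; ring
      · have : ∃ h ∈ A (i + 1), wdist H w h y ≤ wdist H w a y := by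
          by_contra! hcon
          exact hyC ⟨ne_top_of_le_ne_top (EReal.coe_ne_top _) hay, hcon⟩
        obtain ⟨h, hh, hhy⟩ := this
        obtain ⟨i', a', h'⟩ := ih (i + 1) (by omega) y x
          (hxy.elim (fun h => Or.inr h.symm) fun h => Or.inl h.symm) ⟨h, hh, hhy.trans hay'⟩
        exact ⟨i', a', hswap i' a' h'⟩
  exact main N 0 (by omega) u v (Or.inl ⟨rfl, rfl⟩)
    ⟨u, by rw [hA.zero]; exact hu, by simp [wdist_self hw]⟩

theorem nonempty_treeCover (hn : 3 ≤ Fintype.card V) (hw : ∀ e ∈ G.edgeSet, 0 < w e)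
    (R S : Finset V) (hRS : ∀ x ∈ S, x ∉ R) : Nonempty (TreeCover G w R S) := by
  classical
  set H := del G R with hH
  have hwH : ∀ e ∈ H.edgeSet, 0 < w e := pos_of_le (del_le G R) hw
  have hk := one_lt_kpar hn
  obtain ⟨m, hm⟩ : ∃ m, ⌊kpar V⌋₊ = m + 1 := Nat.exists_eq_succ_of_ne_zero (by
    have : 1 ≤ ⌊kpar V⌋₊ := Nat.le_floor (by push_cast; linarith)
    omega)
  have hm1 : (m : ℝ) + 1 ≤ kpar V := by
    have := Nat.floor_le (by linarith : 0 ≤ kpar V)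
    rw [hm] at this; push_cast at this; exact this
  have hm2 : kpar V < m + 2 := by
    have := Nat.lt_floor_add_one (kpar V)
    rw [hm] at this; push_cast at this; linarith
  obtain ⟨A₀, hA0, hAanti, hAcard, hAbunch⟩ :=
    exists_sampling_hierarchy (by omega) (fun x v => wdist H w x v) S
  -- Cutting off after ⌊k⌋ = m + 1 levels keeps the stretch 2i + 1 ≤ 2m + 1 below 2k - 1.
  set A : ℕ → Finset V := fun i => if i < m + 1 then A₀ i else ∅ with hAdef
  have hA : SamplingLevels S (m + 1) A :=
    { zero := by simp [hAdef, hA0]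
      anti := fun i => by
        simp only [hAdef]
        by_cases h : i + 1 < m + 1
        · rw [if_pos h, if_pos (by omega)]; exact hAanti i
        · rw [if_neg h]; simp
      last := by simp [hAdef] }
  choose! lev hlev hlev' using fun x (hx : x ∈ S) => hA.exists_level hx
  choose! T hTverts hTtree hTdep using fun x (hx : x ∈ S) =>
    exists_cluster_tree (del_le G R) hw A (hlev' x hx)
  refine ⟨⟨T, fun x hx => ?_, hTtree, fun x hx v hv => ?_, fun u hu v hv huv => ?_, fun v => ?_⟩⟩
  · rw [hTverts x hx]
    refine ⟨by rw [wdist_self hwH]; simp, fun h hh => ?_⟩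
    rw [wdist_self hwH]
    exact wdist_pos hwH (by rintro rfl; exact hlev' _ hx hh)
  · rw [hTverts x hx] at hv
    obtain ⟨⟨p, _⟩, -⟩ := exists_path_of_wdist_ne_top hv.1
    exact notMem_of_mem_support_del p (hRS x hx) v p.end_mem_support
  · obtain ⟨⟨p, _⟩, hp⟩ := exists_path_of_wdist_ne_top huv
    obtain ⟨i, a, hi, ha, ha', huC, hvC, s, t, hs, ht, hst⟩ :=
      exists_common_cluster hwH hA (wlen_nonneg hwH p) hp.le hu
    have haS : a ∈ S := by
      have : Antitone A := antitone_nat_of_succ_le hA.anti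
      rw [← hA.zero]
      exact this (Nat.zero_le i) ha
    have hia : lev a = i := hA.level_unique (hlev a haS) (hlev' a haS) ha ha'
    have hverts := hTverts a haS
    rw [hia] at hverts
    refine ⟨a, haS, by rw [hverts]; exact huC, by rw [hverts]; exact hvC, ?_⟩
    have h1 := hTdep a haS
    rw [hia] at h1
    refine (add_le_add ((h1 u huC).trans hs) ((h1 v hvC).trans ht)).trans ?_
    rw [hp]
    have h2 : ((2 * i + 1 : ℝ)) ≤ 2 * kpar V - 1 := by
      have : (i : ℝ) ≤ m := by exact_mod_cast Nat.lt_succ_iff.1 hi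
      linarith
    have h3 := mul_le_mul_of_nonneg_right h2 (wlen_nonneg hwH p)
    exact_mod_cast hst.trans h3
  · rw [card_rpow_inv_kpar hn]
    have hsub : {x : V | x ∈ S ∧ v ∈ (T x).verts} ⊆
        (((Finset.range (m + 1)).biUnion fun i =>
          (A i).filter fun x => ∀ h ∈ A (i + 1), wdist H w x v < wdist H w h v : Finset V) :
            Set V) := by
      rintro x ⟨hx, hv⟩
      rw [hTverts x hx] at hv
      simp only [Finset.coe_biUnion, Set.mem_iUnion, Finset.mem_coe, Finset.mem_filter,
        Finset.mem_range]
      refine ⟨lev x, ?_, hlev x hx, hv.2⟩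
      by_contra hcon
      have h := hlev x hx
      have e : A (lev x) = ∅ := if_neg hcon
      rw [e] at h
      simp at h
    have h1 := Set.ncard_le_ncard hsub (Finset.finite_toSet _)
    rw [Set.ncard_coe_finset] at h1
    have h2 := h1.trans Finset.card_biUnion_le
    rw [Finset.sum_range_succ] at h2
    have h3 : ((∑ i ∈ Finset.range m, ((A i).filter fun x =>
        ∀ h ∈ A (i + 1), wdist H w x v < wdist H w h v).card : ℕ) : ℝ)
        ≤ m * (Real.exp 1 * (kpar V + 1)) := by
      push_cast
      refine (Finset.sum_le_card_nsmul (Finset.range m) _ _ fun i hi => ?_).trans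
        (le_of_eq (by rw [Finset.card_range, nsmul_eq_mul]))
      have hi' := Finset.mem_range.1 hi
      have e1 : A i = A₀ i := if_pos (by omega)
      have e2 : A (i + 1) = A₀ (i + 1) := if_pos (by omega)
      rw [e1, e2]
      exact hAbunch i v
    have h4 : (((A m).card : ℕ) : ℝ) ≤ Real.exp (kpar V - m) := by
      have e1 : A m = A₀ m := if_pos (by omega)
      have h5 := hAcard m
      rw [← Real.exp_nat_mul, mul_one] at h5
      have hn0 : (0 : ℝ) < Fintype.card V := by exact_mod_cast (by omega : 0 < Fintype.card V)
      rw [e1, Real.exp_sub, le_div_iff₀ (Real.exp_pos _)]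
      exact h5.trans (Real.exp_log hn0).ge
    have h5 : (((A m).filter fun x =>
        ∀ h ∈ A (m + 1), wdist H w x v < wdist H w h v).card : ℝ) ≤ ((A m).card : ℝ) := by
      exact_mod_cast Finset.card_filter_le _ _
    have h6 := overlap_sum_le hm1 hm2
    have h7 := (Nat.cast_le (α := ℝ)).2 h2
    rw [Nat.cast_add] at h7
    exact (h7.trans (add_le_add h3 (h5.trans h4))).trans h6

theorem nonempty_covers [DecidableEq V] (hn : 3 ≤ Fintype.card V)
    (hw : ∀ e ∈ G.edgeSet, 0 < w e) : Nonempty (Covers G w) :=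
  ⟨fun R S => (nonempty_treeCover hn hw R (S \ R)
    fun _ hx => (Finset.mem_sdiff.1 hx).2).some⟩

end TreeCoverExistence

/-! ### Counting vertices of high pseudo-degree. -/

section HighDegree

/-- A forest extends to a spanning tree of the complete graph. -/
theorem sum_degree_le_of_isAcyclic {W : Type*} [Fintype W] {F : SimpleGraph W}
    (hF : F.IsAcyclic) : ∑ v, (F.neighborSet v).ncard ≤ 2 * Fintype.card W := by
  classical
  rcases isEmpty_or_nonempty W with h | h
  · simp
  obtain ⟨T, hFT, -, hT⟩ :=
    (connected_top (V := W)).exists_isTree_le_of_le_of_isAcyclic le_top hF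
  have h1 := hT.card_edgeFinset
  have h2 : F.edgeFinset.card ≤ T.edgeFinset.card :=
    Finset.card_le_card (SimpleGraph.edgeFinset_mono hFT)
  have h3 := F.sum_degrees_eq_twice_card_edges
  have h4 : ∀ v, (F.neighborSet v).ncard = F.degree v := fun v => by
    rw [← SimpleGraph.card_neighborSet_eq_degree, Set.ncard_eq_toFinset_card', Set.toFinset_card]
  simp only [h4]
  omega

variable {V : Type*} {G : SimpleGraph V}

theorem trunk_subset_verts (T : G.Subgraph) (S : Finset V) : trunk T S ⊆ T.verts := by
  rintro v ⟨a, -, b, -, ha, -, p, hv⟩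
  exact mem_verts_of_mem_support _ ha v hv

/-- Such a vertex is interior to a path between two sources, and both its neighbours on that path
are trunk vertices. -/
theorem two_le_pdeg [Finite V] (T : G.Subgraph) (S : Finset V) {v : V} (hv : v ∈ trunk T S)
    (hvS : v ∉ S) : 2 ≤ pdeg T S v := by
  obtain ⟨a, haS, b, hbS, ha, hb, p, hvp⟩ := id hv
  obtain ⟨i, rfl, hi⟩ := Walk.mem_support_iff_exists_getVert.1 hvp
  have hi0 : i ≠ 0 := by rintro rfl; exact hvS (by simpa using haS)
  have hil : i < (p : T.spanningCoe.Walk a b).length := by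
    refine lt_of_le_of_ne hi ?_
    rintro rfl
    exact hvS (by simpa using hbS)
  rw [← p.2.ncard_neighborSet_toSubgraph_internal_eq_two hi0 hil]
  refine Set.ncard_le_ncard (fun x hx => ?_) (Set.toFinite _)
  refine ⟨hv, ⟨a, haS, b, hbS, ha, hb, p, ?_⟩, Subgraph.adj_sub _ hx⟩
  have := (Walk.toSubgraph (p : T.spanningCoe.Walk a b)).edge_vert (Subgraph.symm _ |>.symm _ _ hx)
  simpa using this

theorem sum_pdeg_le [Fintype V] {T : G.Subgraph} (hT : T.coe.IsAcyclic) (S K : Finset V)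
    (hK : ∀ v, v ∈ K ↔ v ∈ trunk T S) : ∑ v ∈ K, pdeg T S v ≤ 2 * K.card := by
  have h1 := sum_degree_le_of_isAcyclic ((isAcyclic_spanningCoe hT).induce {v | v ∈ K})
  have hc : Fintype.card {v | v ∈ K} = K.card := Fintype.card_coe K
  rw [hc] at h1
  refine le_trans (le_of_eq ?_) h1
  rw [← Finset.sum_coe_sort]
  refine Finset.sum_congr rfl fun v _ => ?_
  rw [← Set.ncard_image_of_injective _ Subtype.val_injective]
  unfold pdeg
  congr 1
  ext x
  simp only [Set.mem_ofPred_eq, Set.mem_image, mem_neighborSet, Subtype.exists, ← hK]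
  constructor
  · rintro ⟨h1, h2, h3⟩
    exact ⟨x, h2, h3, rfl⟩
  · rintro ⟨y, h1, h2, rfl⟩
    exact ⟨v.2, h1, h2⟩

open Classical in
-- The excess (pseudo-degree minus 2) sums to at most 0 over the trunk. Only sources can have
-- negative excess, and then at least -2, so they pay for all the high-degree vertices.
theorem card_high_pdeg_le [Fintype V] {T : G.Subgraph} (hT : T.coe.IsAcyclic) (S : Finset V)
    {s : ℝ} (hs : 2 ≤ s) :
    ((Finset.univ.filter fun v => s < (pdeg T S v : ℝ)).card : ℝ) * (s - 2)
      ≤ 2 * ((S.filter fun v => v ∈ T.verts).card : ℝ) := by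
  set K : Finset V := Finset.univ.filter fun v => v ∈ trunk T S with hK
  have hKm : ∀ v, v ∈ K ↔ v ∈ trunk T S := fun v => by simp [hK]
  have h1 : (∑ v ∈ K, (pdeg T S v : ℝ)) ≤ ∑ _v ∈ K, (2 : ℝ) := by
    have := sum_pdeg_le hT S K hKm
    rw [Finset.sum_const, nsmul_eq_mul, mul_comm]
    exact_mod_cast this
  have h2 : ∀ v ∈ K, (if s < (pdeg T S v : ℝ) then s - 2 else 0)
      ≤ (pdeg T S v : ℝ) - 2 + (if v ∈ S then 2 else 0) := by
    intro v hv
    have h0 : (0 : ℝ) ≤ pdeg T S v := Nat.cast_nonneg _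
    by_cases hvS : v ∈ S
    · split_ifs <;> linarith
    · have : (2 : ℝ) ≤ pdeg T S v := by exact_mod_cast two_le_pdeg T S ((hKm v).1 hv) hvS
      split_ifs <;> linarith
  have h3 := Finset.sum_le_sum h2
  rw [Finset.sum_add_distrib, Finset.sum_sub_distrib, ← Finset.sum_filter, ← Finset.sum_filter] at h3
  simp only [Finset.sum_const, nsmul_eq_mul] at h1 h3
  have h4 : (Finset.univ.filter fun v => s < (pdeg T S v : ℝ))
      = K.filter fun v => s < (pdeg T S v : ℝ) := by
    ext v
    simp only [Finset.mem_filter, Finset.mem_univ, true_and, hKm]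
    refine ⟨fun h => ⟨?_, h⟩, fun h => h.2⟩
    have hpos : 0 < pdeg T S v := by
      have : (0 : ℝ) < pdeg T S v := by linarith
      exact_mod_cast this
    obtain ⟨x, hx⟩ := (Set.ncard_pos (Set.toFinite _)).1 hpos
    exact hx.1
  have h5 : ((K.filter fun v => v ∈ S).card : ℝ) ≤ ((S.filter fun v => v ∈ T.verts).card : ℝ) := by
    refine Nat.cast_le.2 (Finset.card_le_card fun v hv => ?_)
    rw [Finset.mem_filter] at hv ⊢
    exact ⟨hv.2, trunk_subset_verts T S ((hKm v).1 hv.1)⟩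
  rw [h4]
  linarith

variable [Fintype V] {w : Sym2 V → ℝ}

theorem overlap_le (hn : 3 ≤ Fintype.card V) {R S : Finset V} (C : TreeCover G w R S) (v : V) :
    (({x : V | x ∈ S ∧ v ∈ (C.tree x).verts}.ncard : ℕ) : ℝ)
      ≤ Real.exp 1 * kpar V * (kpar V + 1) := by
  have := C.overlap v
  rw [card_rpow_inv_kpar hn] at this
  refine this.trans (le_of_eq ?_)
  unfold kpar
  ring

theorem four_le_rpow_nat {d : ℕ} (hd : 2 ≤ d) {c : ℝ} (hc : 1 ≤ c) : 4 ≤ (d : ℝ) ^ (c + 1) := by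
  have h2 : (2 : ℝ) ≤ d := by exact_mod_cast hd
  calc (4 : ℝ) = 2 ^ (2 : ℝ) := by norm_num
    _ ≤ (d : ℝ) ^ (2 : ℝ) := Real.rpow_le_rpow (by norm_num) h2 (by norm_num)
    _ ≤ (d : ℝ) ^ (c + 1) := Real.rpow_le_rpow_of_exponent_le (by linarith) (by linarith)

/-- The difference of the two sides is 2e·d^(c+1)·k(k - 1) - 1, which is positive because k(k - 1) ≥
0.09 and e·d^(c+1) ≥ 8. -/
theorem two_le_threshold (hn : 3 ≤ Fintype.card V) {c : ℝ} (hc : 1 ≤ c) {d : ℕ} (hd : 2 ≤ d) :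
    2 * (Real.exp 1 * kpar V * (kpar V + 1)) * (d : ℝ) ^ (c + 1) ≤ threshold V c d - 2 := by
  have hk := one_lt_kpar hn
  have hd4 := four_le_rpow_nat hd hc
  have he : (2 : ℝ) ≤ Real.exp 1 := by have := Real.exp_one_gt_d9; linarith
  change _ ≤ 4 * Real.exp 1 * (d : ℝ) ^ (c + 1) * kpar V ^ 2 + 1 - 2
  have h1 : (0.09 : ℝ) ≤ kpar V * (kpar V - 1) := by nlinarith
  have h2 : (8 : ℝ) ≤ Real.exp 1 * (d : ℝ) ^ (c + 1) := by nlinarith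
  have h3 : (8 : ℝ) * 0.09 ≤ Real.exp 1 * (d : ℝ) ^ (c + 1) * (kpar V * (kpar V - 1)) :=
    mul_le_mul h2 h1 (by norm_num) (by positivity)
  nlinarith

open Classical in
-- Sum `card_high_pdeg_le` over the trees. Exchanging the order of summation, the sources are
-- counted once per tree through them, which the overlap bounds.
theorem card_Hi_mul_le (hn : 3 ≤ Fintype.card V) {c : ℝ} (hc : 1 ≤ c) {d : ℕ} (hd : 2 ≤ d)
    {R S : Finset V} (C : TreeCover G w R S) :
    ((Hi C c d).card : ℝ) * (d : ℝ) ^ (c + 1) ≤ S.card := by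
  have hk := one_lt_kpar hn
  have hd4 := four_le_rpow_nat hd hc
  have hE : 0 < Real.exp 1 * kpar V * (kpar V + 1) := by
    have := Real.exp_pos 1
    have : 0 < kpar V := by linarith
    positivity
  have ht := two_le_threshold (V := V) hn hc hd
  set s := threshold V c d
  set E := Real.exp 1 * kpar V * (kpar V + 1)
  have hs : 2 ≤ s := by nlinarith
  have h1 : Hi C c d ⊆ S.biUnion fun x =>
      Finset.univ.filter fun v => s < (pdeg (C.tree x) S v : ℝ) := by
    intro v hv
    simp only [Hi, Finset.mem_filter, Finset.mem_univ, true_and] at hv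
    simpa using hv
  have h2 : ((Hi C c d).card : ℝ) ≤ ∑ x ∈ S,
      ((Finset.univ.filter fun v => s < (pdeg (C.tree x) S v : ℝ)).card : ℝ) := by
    exact_mod_cast (Finset.card_le_card h1).trans Finset.card_biUnion_le
  have h3 : ((Hi C c d).card : ℝ) * (s - 2) ≤
      ∑ x ∈ S, 2 * ((S.filter fun v => v ∈ (C.tree x).verts).card : ℝ) := by
    refine (mul_le_mul_of_nonneg_right h2 (by linarith)).trans ?_
    rw [Finset.sum_mul]
    exact Finset.sum_le_sum fun x hx => card_high_pdeg_le (C.isTree x hx).isAcyclic S hs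
  have h4 : ∑ x ∈ S, 2 * ((S.filter fun v => v ∈ (C.tree x).verts).card : ℝ)
      = ∑ v ∈ S, 2 * (({x : V | x ∈ S ∧ v ∈ (C.tree x).verts}.ncard : ℕ) : ℝ) := by
    rw [← Finset.mul_sum, ← Finset.mul_sum]
    congr 1
    have : ∀ v, ({x : V | x ∈ S ∧ v ∈ (C.tree x).verts}.ncard)
        = (S.filter fun x => v ∈ (C.tree x).verts).card := fun v => by
      rw [← Set.ncard_coe_finset]; congr 1; ext; simp
    simp only [this, Finset.card_filter]
    exact_mod_cast Finset.sum_comm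
  have h5 : ∑ v ∈ S, 2 * (({x : V | x ∈ S ∧ v ∈ (C.tree x).verts}.ncard : ℕ) : ℝ)
      ≤ S.card * (2 * E) := by
    rw [← nsmul_eq_mul]
    exact Finset.sum_le_card_nsmul _ _ _ fun v _ => by
      have := overlap_le hn C v
      linarith
  rw [h4] at h3
  have h6 := mul_le_mul_of_nonneg_left ht (Nat.cast_nonneg (Hi C c d).card : (0 : ℝ) ≤ _)
  have h7 : (2 * E) * (((Hi C c d).card : ℝ) * (d : ℝ) ^ (c + 1)) ≤ (2 * E) * S.card := by
    nlinarith
  exact le_of_mul_le_mul_left h7 (by positivity)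

end HighDegree

/-! ### The path finding algorithm. -/

section QueryPath

variable {V : Type*} [Fintype V] [DecidableEq V] {G : SimpleGraph V} {w : Sym2 V → ℝ}

theorem card_Wset_mul_le (hn : 3 ≤ Fintype.card V) {c : ℝ} (hc : 1 ≤ c) {d : ℕ} (hd : 2 ≤ d)
    (C : Covers G w) (U : Finset V) (j : ℕ) :
    ((Wset C c d U j).card : ℝ) * (d : ℝ) ^ (c + 1) ≤ j * U.card := by
  induction j with
  | zero => simp [Wset]
  | succ j ih =>
    have h1 := card_Hi_mul_le hn hc hd (C (Wset C c d U j) U)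
    have h2 : ((U \ Wset C c d U j).card : ℝ) ≤ U.card := by
      exact_mod_cast Finset.card_le_card Finset.sdiff_subset
    have h3 : ((Wset C c d U (j + 1)).card : ℝ) ≤
        (Wset C c d U j).card + (Hi (C (Wset C c d U j) U) c d).card := by
      exact_mod_cast Finset.card_union_le _ _
    have h4 := mul_le_mul_of_nonneg_right h3 (by positivity : 0 ≤ (d : ℝ) ^ (c + 1))
    push_cast
    linarith

theorem card_child_mul_le (hn : 3 ≤ Fintype.card V) {c : ℝ} (hc : 1 ≤ c) {d : ℕ} (hd : 2 ≤ d)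
    (C : Covers G w) (U : Finset V) {j : ℕ} (hj : j ≤ d) :
    ((Wset C c d U j).card : ℝ) * (d : ℝ) ^ c ≤ U.card := by
  have hd0 : (0 : ℝ) < d := by exact_mod_cast (by omega : 0 < d)
  have h1 := card_Wset_mul_le hn hc hd C U j
  rw [Real.rpow_add_one hd0.ne'] at h1
  have h2 : (j : ℝ) * U.card ≤ d * U.card :=
    mul_le_mul_of_nonneg_right (by exact_mod_cast hj) (Nat.cast_nonneg _)
  nlinarith

theorem Hi_eq_empty_of_card_lt (hn : 3 ≤ Fintype.card V) {c : ℝ} (hc : 1 ≤ c) {d : ℕ}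
    (hd : 2 ≤ d) (C : Covers G w) (U : Finset V) (hU : (U.card : ℝ) < (d : ℝ) ^ c) :
    Hi (C ∅ U) c d = ∅ := by
  have h1 := card_child_mul_le hn hc hd C U (j := 1) (by omega)
  have h2 : Wset C c d U 1 = Hi (C ∅ U) c d := Finset.empty_union _
  rw [h2] at h1
  have hpos : 0 < (d : ℝ) ^ c := Real.rpow_pos_of_pos (by exact_mod_cast (by omega : 0 < d)) _
  have h3 : ((Hi (C ∅ U) c d).card : ℝ) < 1 := by
    by_contra! hcon
    nlinarith
  rw [← Finset.card_eq_zero]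
  exact Nat.lt_one_iff.1 (by exact_mod_cast h3)

/-- If j < d, the next layer W_{j+1} \ W_j misses D by the choice of j. If j = d, each of the d
disjoint layers contains an element of D, so D ⊆ W_d and no such x exists. -/
theorem notMem_Hi_of_notMem_child {c : ℝ} {d : ℕ} (C : Covers G w) {D : Finset V}
    (hD : D.card ≤ d) (U : Finset V) {x : V} (hx : x ∈ D)
    (hxW : x ∉ Wset C c d U (jIndex C c d D U)) :
    x ∉ Hi (C (Wset C c d U (jIndex C c d D U)) U) c d := by
  set j := jIndex C c d D U with hj
  have hne : {j | j ≤ d ∧ D ∩ (Wset C c d U (min (j + 1) d) \ Wset C c d U j) = ∅}.Nonempty :=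
    ⟨d, le_refl d, by simp⟩
  obtain ⟨hjd, hjD⟩ := Nat.sInf_mem hne
  rw [show sInf _ = j from rfl] at hjd hjD
  rcases hjd.lt_or_eq with hlt | heq
  · intro hxH
    rw [min_eq_left (by omega)] at hjD
    have : x ∈ D ∩ (Wset C c d U (j + 1) \ Wset C c d U j) := by
      simp only [Finset.mem_inter, Finset.mem_sdiff]
      exact ⟨hx, Finset.mem_union_right _ hxH, hxW⟩
    rw [hjD] at this
    simp at this
  · exfalso
    have hgrow : ∀ i ≤ d, i ≤ (D ∩ Wset C c d U i).card := by
      intro i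
      induction i with
      | zero => simp
      | succ i ih =>
        intro hi
        have h1 := ih (by omega)
        have h2 : ¬ (i ≤ d ∧ D ∩ (Wset C c d U (min (i + 1) d) \ Wset C c d U i) = ∅) :=
          Nat.notMem_of_lt_sInf (show i < j by omega)
        rw [min_eq_left hi] at h2
        push Not at h2
        obtain ⟨y, hy⟩ := h2 (by omega)
        simp only [Finset.mem_inter, Finset.mem_sdiff] at hy
        have h3 : D ∩ Wset C c d U i ⊂ D ∩ Wset C c d U (i + 1) := by
          have hsub : Wset C c d U i ⊆ Wset C c d U (i + 1) := Finset.subset_union_left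
          rw [Finset.ssubset_iff_of_subset (Finset.inter_subset_inter_left hsub)]
          exact ⟨y, by simp [hy], by simp [hy]⟩
        have := Finset.card_lt_card h3
        omega
    have h1 := hgrow d le_rfl
    have h2 : D ∩ Wset C c d U d = D :=
      Finset.eq_of_subset_of_card_le Finset.inter_subset_left (by omega)
    rw [heq] at hxW
    rw [← h2] at hx
    exact hxW (Finset.mem_inter.1 hx).2

theorem length_findPath_le (C : Covers G w) (c : ℝ) (d : ℕ) (D : Finset V) (f : ℕ) (U : Finset V) :
    (findPath C c d D f U).length ≤ f + 1 := by
  induction f generalizing U with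
  | zero => simp [findPath]
  | succ f ih =>
    simp only [findPath]
    split_ifs
    · simp
    · simpa using ih _

/-- The vertices of `D` have small pseudo-degree in the covers that `L` selects. -/
def LowDegreeAlong (C : Covers G w) (c : ℝ) (d : ℕ) (D : Finset V) (L : List (Finset V)) : Prop :=
  ∀ i < L.length, ∀ x ∈ D, x ∉ L.getD (i + 1) ∅ → x ∉ Hi (C (L.getD (i + 1) ∅) (L.getD i ∅)) c d

/-- Every step shrinks the node by a factor d^c, so the size hypothesis passes to the child with one
step fewer. When the steps run out, fewer than d^c vertices are left, and the node is a leaf. -/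
theorem lowDegreeAlong_findPath (hn : 3 ≤ Fintype.card V) {c : ℝ} (hc : 1 ≤ c) {d : ℕ}
    (hd : 2 ≤ d) (C : Covers G w) {D : Finset V} (hD : D.card ≤ d) (f : ℕ) (U : Finset V)
    (hU : (U.card : ℝ) < (d : ℝ) ^ (c * (f + 1))) :
    LowDegreeAlong C c d D (findPath C c d D f U) := by
  have hsing : ∀ U, Hi (C ∅ U) c d = ∅ → LowDegreeAlong C c d D [U] := by
    intro U hU i hi x hx _
    obtain rfl : i = 0 := by simpa using hi
    change x ∉ Hi (C ∅ U) c d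
    simp [hU]
  have hd0 : (0 : ℝ) < d := by exact_mod_cast (by omega : 0 < d)
  induction f generalizing U with
  | zero => exact hsing U (Hi_eq_empty_of_card_lt hn hc hd C U (by simpa using hU))
  | succ f ih =>
    by_cases hleaf : IsLeaf C c d U
    · simp only [findPath, hleaf, true_or, if_true]
      exact hsing U hleaf
    by_cases hj : jIndex C c d D U = 0
    · simp only [findPath, hj, or_true, if_true]
      intro i hi x hx _
      obtain rfl : i = 0 := by simpa using hi
      have := notMem_Hi_of_notMem_child (c := c) (d := d) C hD U hx
      rw [hj] at this
      exact this (by simp [Wset])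
    · simp only [findPath, hleaf, hj, or_self, if_false]
      set W := Wset C c d U (jIndex C c d D U) with hW
      have hhead := (findPath_spec C c d D f W).1
      have hWc : (W.card : ℝ) < (d : ℝ) ^ (c * (f + 1)) := by
        have h1 := card_child_mul_le hn hc hd C U (jIndex_le C c d D U)
        have h2 : (d : ℝ) ^ (c * ((f + 1 : ℕ) + 1)) = (d : ℝ) ^ (c * (f + 1)) * (d : ℝ) ^ c := by
          rw [← Real.rpow_add hd0]; congr 1; push_cast; ring
        rw [h2] at hU
        exact lt_of_mul_lt_mul_right (h1.trans_lt hU) (by positivity)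
      intro i hi x hx
      cases i with
      | zero =>
        have h0 : (findPath C c d D f W).getD 0 ∅ = W := by
          rw [List.getD_eq_getElem?_getD, ← List.head?_eq_getElem?, hhead]
          rfl
        have h1 : (U :: findPath C c d D f W).getD (0 + 1) ∅ = W := h0
        rw [h1]
        exact notMem_Hi_of_notMem_child C hD U hx
      | succ i =>
        simp only [List.getD_cons_succ]
        exact ih W hWc i (by simpa using hi) x hx

theorem lowDegreeAlong_queryPath (hn : 3 ≤ Fintype.card V) {c : ℝ} (hc : 1 ≤ c) {d : ℕ}
    (hd : 2 ≤ d) (C : Covers G w) {D : Finset V} (hD : D.card ≤ d) :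
    LowDegreeAlong C c d D (queryPath C c d D) := by
  refine lowDegreeAlong_findPath hn hc hd C hD _ _ ?_
  have hd1 : (1 : ℝ) < d := by exact_mod_cast (by omega : 1 < d)
  have hn0 : (0 : ℝ) < Fintype.card V := by exact_mod_cast (by omega : 0 < Fintype.card V)
  have h1 := Nat.lt_floor_add_one ((1 / c) * Real.logb d (Fintype.card V))
  rw [Finset.card_univ, ← Real.logb_lt_iff_lt_rpow hd1 hn0]
  change (1 / c) * Real.logb d (Fintype.card V) < (depthBound V c d : ℝ) + 1 at h1
  rwa [one_div_mul_eq_div, div_lt_iff₀' (by linarith)] at h1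

theorem length_queryPath_le (C : Covers G w) (c : ℝ) (d : ℕ) (D : Finset V) :
    (queryPath C c d D).length ≤ depthBound V c d + 1 :=
  length_findPath_le C c d D _ _

end QueryPath

/-! ### Euler tours. -/

section EulerTours

variable {V : Type*} {G : SimpleGraph V}

/-- The recorded vertices can be left only through p; hence a full tour contains the whole component
of the root. -/
theorem DFSForest.closed {T : G.Subgraph} {p : V} {ys l : List V} (h : DFSForest T p ys l) :
    (∀ y ∈ ys, y ∈ l) ∧ ∀ y ∈ l, ∀ z, T.Adj y z → z ∈ l ∨ z = p := by
  induction h with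
  | nil p => simp
  | cons p y ys cs l l' hnd hcs h h' ih ih' =>
    refine ⟨fun x hx => ?_, fun x hx z hz => ?_⟩
    · rcases List.mem_cons.1 hx with rfl | hx
      · simp
      · simp [ih'.1 x hx]
    · simp only [List.mem_cons, List.mem_append] at hx ⊢
      rcases hx with rfl | hx | hx
      · by_cases hzp : z = p
        · exact Or.inr hzp
        · exact Or.inl (Or.inr (Or.inl (ih.1 z ((hcs z).2 ⟨hz, hzp⟩))))
      · rcases ih.2 x hx z hz with h | h
        · exact Or.inl (Or.inr (Or.inl h))
        · exact Or.inl (Or.inl h)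
      · rcases ih'.2 x hx z hz with h | h
        · exact Or.inl (Or.inr (Or.inr h))
        · exact Or.inr h

theorem IsEulerTour.mem {T : G.Subgraph} {r : V} {l : List V} (h : IsEulerTour T r l) {v : V}
    (hv : T.spanningCoe.Reachable r v) : v ∈ l := by
  obtain ⟨cs, l', -, hcs, hl', rfl⟩ := h
  obtain ⟨p⟩ := hv
  have key : ∀ a b : V, T.spanningCoe.Walk a b → a ∈ r :: l' → b ∈ r :: l' := by
    intro a b p
    induction p with
    | nil => exact id
    | @cons a b _ hab p ih =>
      intro ha
      refine ih ?_
      rcases List.mem_cons.1 ha with rfl | ha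
      · exact List.mem_cons_of_mem _ (hl'.closed.1 b ((hcs b).2 hab))
      · rcases hl'.closed.2 a ha b hab with h | h
        · exact List.mem_cons_of_mem _ h
        · simp [h]
  exact key r v p (by simp)

/-- The search terminates because the path q from the root stays simple: in a forest, the only
neighbour of its end on q is the penultimate vertex. N bounds the remaining depth. -/
theorem exists_dfsForest [Fintype V] {T : G.Subgraph} (hT : T.spanningCoe.IsAcyclic) {r : V}
    (N : ℕ) : ∀ {y : V} (q : T.spanningCoe.Walk r y), q.IsPath → Fintype.card V ≤ N + q.length →
      ∀ ys : List V, (∀ z ∈ ys, T.Adj y z ∧ z ≠ q.penultimate) → ∃ l, DFSForest T y ys l := by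
  classical
  induction N with
  | zero =>
    intro y q hq hN
    exact absurd hq.length_lt (by omega)
  | succ N ih =>
    intro y q hq hN ys
    induction ys with
    | nil => exact fun _ => ⟨[], .nil y⟩
    | cons z zs ihz =>
      intro hys
      obtain ⟨hyz, hzp⟩ := hys z (by simp)
      have hyz' : T.spanningCoe.Adj y z := hyz
      have hzq : z ∉ q.support := fun h => hzp (hT.eq_penultimate_of_adj_end hq hyz' h)
      obtain ⟨l', hl'⟩ := ihz fun x hx => hys x (List.mem_cons_of_mem _ hx)
      set cs := (Finset.univ.filter fun x => T.Adj z x ∧ x ≠ y).toList with hcs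
      have hmem : ∀ x, x ∈ cs ↔ T.Adj z x ∧ x ≠ y := fun x => by simp [hcs]
      obtain ⟨l, hl⟩ := ih (q.concat hyz') (hq.concat hzq hyz')
        (by rw [Walk.length_concat]; omega) cs (fun x hx => by
          rw [Walk.penultimate_concat]; exact (hmem x).1 hx)
      exact ⟨_, .cons y z zs cs l l' (Finset.nodup_toList _) hmem hl hl'⟩

theorem exists_isEulerTour [Fintype V] {T : G.Subgraph} (hT : T.spanningCoe.IsAcyclic) (r : V) :
    ∃ l, IsEulerTour T r l := by
  classical
  set cs := (Finset.univ.filter fun x => T.Adj r x).toList with hcs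
  have hmem : ∀ x, x ∈ cs ↔ T.Adj r x := fun x => by simp [hcs]
  obtain ⟨l, hl⟩ := exists_dfsForest hT (Fintype.card V) (Walk.nil : T.spanningCoe.Walk r r)
    Walk.IsPath.nil (by simp) cs (fun z hz => ⟨(hmem z).1 hz, by
      simpa using ((hmem z).1 hz).ne.symm⟩)
  exact ⟨_, cs, l, Finset.nodup_toList _, hmem, hl, rfl⟩

theorem exists_position {order : List (ℕ × V)} {tour : ℕ × V → List V} {t : ℕ × V} {x : V}
    (ht : t ∈ order) (hx : x ∈ tour t) : ∃ q : ℕ, (concatTours order tour)[q]? = some (t, x) := by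
  refine List.mem_iff_getElem?.1 ?_
  simp only [concatTours, List.mem_flatMap, List.mem_map]
  exact ⟨t, ht, x, hx, rfl⟩

end EulerTours

/-! ### Trees after pruning. -/

section PrunedTrees

variable {V : Type*} [Fintype V] [DecidableEq V] {G : SimpleGraph V} {w : Sym2 V → ℝ}

theorem fullTree_isTree (C : Covers G w) {L : List (Finset V)} {t : ℕ × V} (ht : t ∈ trees L) :
    (fullTree C L t).coe.IsTree :=
  (C (L.getD (t.1 + 1) ∅) (L.getD t.1 ∅)).isTree t.2 ht.2

theorem fullTree_spanningCoe_isAcyclic (C : Covers G w) {L : List (Finset V)} {t : ℕ × V}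
    (ht : t ∈ trees L) : (fullTree C L t).spanningCoe.IsAcyclic :=
  isAcyclic_spanningCoe (fullTree_isTree C ht).isAcyclic

theorem tree_le_fullTree (C : Covers G w) (ρ : ℝ) (L : List (Finset V)) (t : ℕ × V) :
    tree C ρ L t ≤ fullTree C L t :=
  ⟨fun _ hv => hv.1, fun _ _ h => h.2.2⟩

theorem tree_spanningCoe_isAcyclic (C : Covers G w) (ρ : ℝ) {L : List (Finset V)} {t : ℕ × V}
    (ht : t ∈ trees L) : (tree C ρ L t).spanningCoe.IsAcyclic :=
  (fullTree_spanningCoe_isAcyclic C ht).anti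
    (Subgraph.spanningCoe_le_of_le (tree_le_fullTree C ρ L t))

/-- Depth does not increase towards the root, so the whole root path of a surviving vertex survives.
-/
theorem exists_tree_walk (hw : ∀ e ∈ G.edgeSet, 0 < w e) (C : Covers G w) (ρ : ℝ)
    {L : List (Finset V)} {t : ℕ × V} (ht : t ∈ trees L) {v : V}
    (hv : v ∈ (tree C ρ L t).verts) :
    ∃ p : (tree C ρ L t).spanningCoe.Walk t.2 v, wlen w p ≤ (2 * kpar V - 1) * ρ := by
  have hwF := spanningCoe_pos hw (fullTree C L t)
  obtain ⟨⟨p, _⟩, -, hp⟩ := exists_path_of_wdist_le hv.2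
  have hr : t.2 ∈ (fullTree C L t).verts :=
    (C (L.getD (t.1 + 1) ∅) (L.getD t.1 ∅)).root_mem t.2 ht.2
  have hsup : ∀ z ∈ p.support, z ∈ (tree C ρ L t).verts := by
    intro z hz
    refine ⟨mem_verts_of_mem_support p hr z hz, (wdist_le_wlen hwF (p.takeUntil z hz)).trans ?_⟩
    have h1 := wlen_dropUntil_add_takeUntil (w := w) p hz
    have h2 := wlen_nonneg hwF (p.dropUntil z hz)
    have h3 : wlen w (p.takeUntil z hz) ≤ (2 * kpar V - 1) * ρ := by
      simp only at hp; linarith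
    exact_mod_cast h3
  have hedge : ∀ e ∈ p.edges, e ∈ (tree C ρ L t).spanningCoe.edgeSet := by
    intro e he
    induction e with
    | _ a b =>
      exact ⟨hsup a (p.fst_mem_support_of_mem_edges he), hsup b (p.snd_mem_support_of_mem_edges he),
        p.adj_of_mem_edges he⟩
  refine ⟨p.transfer _ hedge, ?_⟩
  unfold wlen
  rw [Walk.edges_transfer]
  exact hp

end PrunedTrees

/-! ### Existence of the remaining choices. -/

section OracleExistence

variable {V : Type*} [Fintype V]

/-- Some index along `L` is the last one whose set meets `Q`. -/
theorem exists_last_index {L : List (Finset V)} (hL : L.head? = some Finset.univ) {Q : Set V}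
    (hQ : Q.Nonempty) : ∃ i < L.length, ∃ x ∈ Q, x ∈ L.getD i ∅ ∧ ∀ y ∈ Q, y ∉ L.getD (i + 1) ∅ := by
  by_contra! hcon
  have h0 : ∀ i ≤ L.length, ∃ x ∈ Q, x ∈ L.getD i ∅ := by
    intro i
    induction i with
    | zero =>
      intro _
      obtain ⟨x, hx⟩ := hQ
      refine ⟨x, hx, ?_⟩
      rw [List.getD_eq_getElem?_getD, ← List.head?_eq_getElem?, hL]
      simp
    | succ i ih =>
      intro hi
      obtain ⟨x, hx, hxi⟩ := ih (by omega)
      exact hcon i (by omega) x hx hxi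
  obtain ⟨x, -, hx⟩ := h0 L.length le_rfl
  simp at hx

variable [DecidableEq V] {G : SimpleGraph V} {w : Sym2 V → ℝ}

theorem exists_mem_sources {L : List (Finset V)} (hL : L.head? = some Finset.univ) (x : V) :
    ∃ i, (i, x) ∈ trees L := by
  obtain ⟨i, hi, y, rfl, hy, hy'⟩ := exists_last_index hL (Set.singleton_nonempty x)
  exact ⟨i, hi, Finset.mem_sdiff.2 ⟨hy, hy' _ rfl⟩⟩

theorem finite_trees (L : List (Finset V)) : (trees L).Finite :=
  ((Set.finite_Iio L.length).prod (Set.toFinite (Set.univ : Set V))).subset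
    fun _ ht => ⟨ht.1, trivial⟩

theorem nonempty_pathData
    (C : Covers G w) {ρ : ℝ} {L : List (Finset V)}
    (hL : L.head? = some Finset.univ) : Nonempty (PathData C ρ L) := by
  classical
  set order := (finite_trees L).toFinset.toList with horder
  have hmem : ∀ t, t ∈ order ↔ t ∈ trees L := fun t => by simp [horder]
  choose! tour htour using fun t (ht : t ∈ trees L) =>
    exists_isEulerTour (tree_spanningCoe_isAcyclic C ρ ht) t.2
  set Λ := concatTours order tour with hΛ
  have hocc : ∀ x, ∃ q t, Λ[q]? = some (t, x) := fun x => by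
    obtain ⟨i, hi⟩ := exists_mem_sources hL x
    obtain ⟨q, hq⟩ := exists_position ((hmem _).2 hi) ((htour _ hi).mem (Reachable.refl _))
    exact ⟨q, _, hq⟩
  choose occ hocc using hocc
  -- All intervals together form a covering set with κ = 1; sets of vertices are then represented by
  -- singletons.
  set 𝓘 : Finset (Finset ℕ) := ((Finset.range Λ.length ×ˢ Finset.range Λ.length).filter
    fun q => q.1 ≤ q.2).image fun q => Finset.Icc q.1 q.2 with h𝓘
  have hI : ∀ l r, l ≤ r → r < Λ.length → Finset.Icc l r ∈ 𝓘 := fun l r hlr hr =>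
    Finset.mem_image.2 ⟨(l, r), by simp; omega, rfl⟩
  refine ⟨{ order := order, order_nodup := Finset.nodup_toList _, mem_order := hmem, tour := tour
            isTour := htour, κ := 1, 𝓘 := 𝓘, covering := ⟨fun I hI => ?_, fun l r hlr hr => ?_⟩
            occ := occ, occ_spec := hocc
            rep := fun t X => ((Finset.range Λ.length).filter fun q =>
              ∃ x ∈ X, Λ[q]? = some (t, x)).image fun q => {q}
            rep_subset := fun t _ X _ I hI' => ?_
            rep_union := fun t _ X _ q => ?_ }⟩
  · obtain ⟨⟨l, r⟩, hlr, rfl⟩ := Finset.mem_image.1 hI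
    simp only [Finset.mem_filter, Finset.mem_product, Finset.mem_range] at hlr
    exact ⟨l, r, hlr.2, hlr.1.2, rfl⟩
  · exact ⟨{Finset.Icc l r}, by simpa using hI l r hlr hr, by simp, by simp⟩
  · obtain ⟨q, hq, rfl⟩ := Finset.mem_image.1 hI'
    simp only [Finset.mem_filter, Finset.mem_range] at hq
    have := hI q q
    rw [Finset.Icc_self] at this
    exact this le_rfl hq.1
  · simp only [Finset.mem_image, Finset.mem_filter, Finset.mem_range]
    constructor
    · rintro ⟨_, ⟨q', hq', rfl⟩, hq⟩
      rw [Finset.mem_singleton] at hq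
      rw [hq]
      exact hq'.2
    · rintro ⟨x, hx, hq⟩
      exact ⟨{q}, ⟨q, ⟨(List.getElem?_eq_some_iff.1 hq).1, x, hx, hq⟩, rfl⟩, by simp⟩

theorem nonempty_oracle (hn : 3 ≤ Fintype.card V) (hw : ∀ e ∈ G.edgeSet, 0 < w e) (c : ℝ) (d : ℕ)
    (ρ : ℝ) : Nonempty (Oracle G w c d ρ) := by
  obtain ⟨C⟩ := nonempty_covers hn hw
  exact ⟨⟨C, fun L hL => (nonempty_pathData C hL.1).some⟩⟩

end OracleExistence

/-! ### Splitting walks. -/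

section Segments

variable {V : Type*} {H : SimpleGraph V} {w : Sym2 V → ℝ}

/-- A walk whose end satisfies `Q` splits at the first vertex that satisfies `Q`. -/
theorem exists_first_split (Q : V → Prop) {b v : V} (q : H.Walk b v) (hv : Q v) :
    Q b ∨ ∃ (y z : V) (q₀ : H.Walk b y) (h : H.Adj y z) (q₁ : H.Walk z v), Q z ∧
      (∀ x ∈ q₀.support, ¬ Q x) ∧ q = q₀.append (Walk.cons h q₁) := by
  induction q with
  | nil => exact Or.inl hv
  | @cons b c v h q ih =>
    by_cases hb : Q b
    · exact Or.inl hb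
    refine Or.inr ?_
    rcases ih hv with hc | ⟨y, z, q₀, h', q₁, hz, hq₀, rfl⟩
    · exact ⟨b, c, Walk.nil, h, q, hc, by simpa using hb, rfl⟩
    · refine ⟨y, z, Walk.cons h q₀, h', q₁, hz, ?_, rfl⟩
      intro x hx
      rcases List.mem_cons.1 (by simpa using hx) with rfl | hx
      · exact hb
      · exact hq₀ x hx

end Segments

/-! ### Short distances give the answer Yes. -/

section Completeness

variable {V : Type*} [Fintype V] [DecidableEq V] {G : SimpleGraph V} {w : Sym2 V → ℝ}
  {C : Covers G w} {ρ : ℝ} {L : List (Finset V)}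

/-- The set of vertices of `G` that a vertex of `R` stands for. -/
def RNode.verts {V : Type*} : RNode V → Set V
  | .single x => {x}
  | .sub _ X => X

/-- The connected component of `x` in `T - D` for the tree `T` with index `t`. -/
def component (C : Covers G w) (ρ : ℝ) (L : List (Finset V)) (D : Finset V) (t : ℕ × V) (x : V) :
    Set V :=
  {y | ((tree C ρ L t).deleteVerts (D : Set V)).spanningCoe.Reachable x y}

theorem mem_verts_of_mem_component {D : Finset V} {t : ℕ × V} {x y : V}
    (hx : x ∈ (tree C ρ L t).verts) (hxD : x ∉ D) (hy : y ∈ component C ρ L D t x) :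
    y ∈ (tree C ρ L t).verts ∧ y ∉ D := by
  obtain ⟨p⟩ := hy
  exact mem_verts_of_mem_support p ⟨hx, by simpa using hxD⟩ y p.end_mem_support

theorem IsAffectedSubtree.subset {D : Finset V} {t : ℕ × V} {X : Set V}
    (h : IsAffectedSubtree C ρ L D t X) {y : V} (hy : y ∈ X) :
    y ∈ (tree C ρ L t).verts ∧ y ∉ D := by
  obtain ⟨-, ⟨x, hx, hxD, rfl⟩, -⟩ := h
  exact mem_verts_of_mem_component hx hxD hy

theorem isAffectedSubtree_component {D : Finset V} {t : ℕ × V} {x : V}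
    (ht : IsAffected C ρ L D t) (hx : x ∈ (tree C ρ L t).verts) (hxD : x ∉ D)
    (hxS : x ∈ sources L t.1) : IsAffectedSubtree C ρ L D t (component C ρ L D t x) :=
  ⟨ht, ⟨x, hx, hxD, rfl⟩, x, Reachable.refl x, x, hxS, x, hxS, hx, hx, Path.nil, by simp⟩

/-- A one-point interval is a union of members of the covering set only if it is itself a member. -/
theorem PathData.singleton_mem (P : PathData C ρ L) (x : V) : ({P.occ x} : Finset ℕ) ∈ P.𝓘 := by
  obtain ⟨t, ht⟩ := P.occ_spec x
  obtain ⟨𝒥, h𝒥, -, hU⟩ := P.covering.2 (P.occ x) (P.occ x) le_rfl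
    (List.getElem?_eq_some_iff.1 ht).1
  rw [Finset.Icc_self] at hU
  have hmem : P.occ x ∈ 𝒥.biUnion id := by rw [hU]; simp
  obtain ⟨J, hJ, hxJ⟩ := Finset.mem_biUnion.1 hmem
  have hJs : J = {P.occ x} := by
    refine Finset.eq_singleton_iff_unique_mem.2 ⟨hxJ, fun y hy => ?_⟩
    have : y ∈ 𝒥.biUnion id := Finset.mem_biUnion.2 ⟨J, hJ, hy⟩
    rw [hU] at this
    simpa using this
  rw [← hJs]
  exact h𝒥 hJ

theorem exists_interval (hw : ∀ e ∈ G.edgeSet, 0 < w e) (P : PathData C ρ L) {D : Finset V}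
    {u v : V} {N : RNode V} (hN : IsRVertex C ρ L D u v N) {x : V} (hx : x ∈ N.verts) :
    ∃ I ∈ P.intervals N, I ∈ P.𝓘 ∧ ∃ q ∈ I, ∃ t, P.Λ[q]? = some (t, x) := by
  cases N with
  | single y =>
    obtain rfl : x = y := hx
    exact ⟨{P.occ x}, by simp [PathData.intervals], P.singleton_mem x, P.occ x, by simp,
      P.occ_spec x⟩
  | sub t X =>
    have ht : t ∈ trees L := hN.1.1
    have hX : X ⊆ (tree C ρ L t).verts := fun y hy => (IsAffectedSubtree.subset hN hy).1
    obtain ⟨p, -⟩ := exists_tree_walk hw C ρ ht (hX hx)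
    obtain ⟨q, hq⟩ := exists_position ((P.mem_order t).2 ht) ((P.isTour t ht).mem ⟨p⟩)
    obtain ⟨I, hI, hqI⟩ := (P.rep_union t ht X hX q).2 ⟨x, hx, hq⟩
    exact ⟨I, hI, P.rep_subset t ht X hX hI, q, hqI, t, hq⟩

theorem reachable_of_eq_or_adj (hw : ∀ e ∈ G.edgeSet, 0 < w e) (P : PathData C ρ L)
    {D : Finset V} {u v : V} {N N' : RNode V} (hN : IsRVertex C ρ L D u v N)
    (hN' : IsRVertex C ρ L D u v N') {x y : V} (hx : x ∈ N.verts) (hy : y ∈ N'.verts)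
    (hxy : x = y ∨ (G.Adj x y ∧ w s(x, y) ≤ ρ)) : (RGraph P D u v).Reachable N N' := by
  rcases eq_or_ne N N' with rfl | hne
  · exact Reachable.refl _
  obtain ⟨I, hI, -, q, hq, t, hqt⟩ := exists_interval hw P hN hx
  obtain ⟨J, hJ, -, q', hq', t', hqt'⟩ := exists_interval hw P hN' hy
  exact Adj.reachable ((SimpleGraph.fromRel_adj _ _ _).2 ⟨hne, Or.inl ⟨hN, hN', I, hI, J, hJ,
    Or.inr ⟨q, hq, q', hq', t, x, t', y, hqt, hqt', hxy⟩⟩⟩)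

/-- The common vertex z yields the path I₁ → t₁ → z₁ → t'₂ → J₂ in H, which avoids the affected
trees. -/
theorem reachable_of_trees (hw : ∀ e ∈ G.edgeSet, 0 < w e) (P : PathData C ρ L)
    {D : Finset V} {u v : V} {N N' : RNode V} (hN : IsRVertex C ρ L D u v N)
    (hN' : IsRVertex C ρ L D u v N') {x y b b' z : V} (hx : x ∈ N.verts) (hy : y ∈ N'.verts)
    (hxb : G.Adj x b) (hxb' : w s(x, b) ≤ ρ) (hyb : G.Adj y b') (hyb' : w s(y, b') ≤ ρ)
    {t t' : ℕ × V} (ht : t ∈ trees L) (ht' : t' ∈ trees L)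
    (hta : ¬ IsAffected C ρ L D t) (hta' : ¬ IsAffected C ρ L D t')
    (hb : b ∈ (tree C ρ L t).verts) (hz : z ∈ (tree C ρ L t).verts)
    (hz' : z ∈ (tree C ρ L t').verts) (hb' : b' ∈ (tree C ρ L t').verts) :
    (RGraph P D u v).Reachable N N' := by
  rcases eq_or_ne N N' with rfl | hne
  · exact Reachable.refl _
  obtain ⟨I, hI, hI𝓘, q, hq, s, hqs⟩ := exists_interval hw P hN hx
  obtain ⟨J, hJ, hJ𝓘, q', hq', s', hqs'⟩ := exists_interval hw P hN' hy
  refine Adj.reachable ((SimpleGraph.fromRel_adj _ _ _).2 ⟨hne, Or.inl ⟨hN, hN', I, hI, J, hJ,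
    Or.inl ?_⟩⟩)
  have ne_of : ∀ {t s : ℕ × V}, ¬ IsAffected C ρ L D t → IsAffected C ρ L D s → t ≠ s := by
    rintro t _ h1 h2 rfl
    exact h1 h2
  refine Relation.ReflTransGen.head (b := .tree1 t)
    ⟨.enter I t hI𝓘 ht ⟨x, b, ⟨q, hq, s, hqs⟩, hb, hxb, hxb'⟩, fun s hs => ?_⟩
    (.head (b := .vert z) ⟨.up t z ht hz, fun s hs => ?_⟩
      (.head (b := .tree2 t') ⟨.down t' z ht' hz', fun s hs => ?_⟩
        (.single ⟨.leave J t' hJ𝓘 ht' ⟨y, b', ⟨q', hq', s', hqs'⟩, hb', hyb, hyb'⟩,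
          fun s hs => ?_⟩)))
  all_goals simp [ne_of hta hs, ne_of hta' hs]

theorem exists_tree_of_last_index (hn : 3 ≤ Fintype.card V) (hw : ∀ e ∈ G.edgeSet, 0 < w e)
    {i : ℕ} {x e : V} (hi : i < L.length)
    (hx : x ∈ sources L i) (he : e ∉ L.getD (i + 1) ∅)
    (hxe : wdist (del G (L.getD (i + 1) ∅)) w x e ≤ (ρ : EReal)) :
    ∃ t ∈ trees L, t.1 = i ∧ x ∈ (tree C ρ L t).verts ∧ e ∈ (tree C ρ L t).verts := by
  have hk := one_lt_kpar hn
  obtain ⟨r, hr, hxr, her, hle⟩ := (C (L.getD (i + 1) ∅) (L.getD i ∅)).stretch x hx e he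
    (ne_top_of_le_ne_top (EReal.coe_ne_top _) hxe)
  obtain ⟨p, hp, hpρ⟩ := exists_path_of_wdist_le hxe
  have hle' : dep w ((C (L.getD (i + 1) ∅) (L.getD i ∅)).tree r) r x +
      dep w ((C (L.getD (i + 1) ∅) (L.getD i ∅)).tree r) r e
        ≤ (((2 * kpar V - 1) * ρ : ℝ) : EReal) := by
    refine hle.trans ?_
    rw [hp, ← EReal.coe_mul, EReal.coe_le_coe_iff]
    exact mul_le_mul_of_nonneg_left hpρ (by linarith)
  have hnn := fun v => wdist_nonneg (spanningCoe_pos hw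
    ((C (L.getD (i + 1) ∅) (L.getD i ∅)).tree r)) r v
  exact ⟨(i, r), ⟨hi, hr⟩, rfl, ⟨hxr, (le_add_of_nonneg_right (hnn e)).trans hle'⟩,
    ⟨her, (le_add_of_nonneg_left (hnn x)).trans hle'⟩⟩

/-- By the choice of the last index, the walk avoids U_{i+1} and passes a source x of the i-th
cover. Both ends are within ρ of x, so the stretch property and the pruning radius put each in a
tree with x. -/
theorem exists_trees_of_unmarked (hn : 3 ≤ Fintype.card V) (hw : ∀ e ∈ G.edgeSet, 0 < w e)
    (hL : L.head? = some Finset.univ) {D : Finset V} {b y : V}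
    (q : (del G D).Walk b y) (hq : wlen w q ≤ ρ) (hbD : b ∉ D)
    (hun : ∀ x ∈ q.support, ∀ t X, IsAffectedSubtree C ρ L D t X → x ∉ X) :
    ∃ t ∈ trees L, ∃ t' ∈ trees L, ∃ z, ¬ IsAffected C ρ L D t ∧ ¬ IsAffected C ρ L D t' ∧
      b ∈ (tree C ρ L t).verts ∧ z ∈ (tree C ρ L t).verts ∧
      z ∈ (tree C ρ L t').verts ∧ y ∈ (tree C ρ L t').verts := by
  obtain ⟨i, hi, x, hxq, hxi, hout⟩ := exists_last_index hL (Q := {x | x ∈ q.support})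
    ⟨b, q.start_mem_support⟩
  have hxq : x ∈ q.support := hxq
  have hxS : x ∈ sources L i := Finset.mem_sdiff.2 ⟨hxi, hout x hxq⟩
  set H := del G (L.getD (i + 1) ∅) with hH
  have hwH : ∀ e ∈ H.edgeSet, 0 < w e := pos_of_le (del_le G _) hw
  have hedge : ∀ e ∈ q.edges, e ∈ H.edgeSet := by
    intro e he
    induction e with
    | _ a c =>
      exact ⟨(q.adj_of_mem_edges he).1, hout a (q.fst_mem_support_of_mem_edges he),
        hout c (q.snd_mem_support_of_mem_edges he)⟩
  have hlen : wlen w (q.transfer H hedge) = wlen w q := by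
    unfold wlen; rw [Walk.edges_transfer]
  have hxq' : x ∈ (q.transfer H hedge).support := by rw [Walk.support_transfer]; exact hxq
  have hsplit := wlen_dropUntil_add_takeUntil (w := w) _ hxq'
  have h1 := wlen_nonneg hwH ((q.transfer H hedge).takeUntil x hxq')
  have h2 := wlen_nonneg hwH ((q.transfer H hedge).dropUntil x hxq')
  have hxb : wdist H w x b ≤ (ρ : EReal) := by
    rw [wdist_comm]
    refine (wdist_le_wlen hwH ((q.transfer H hedge).takeUntil x hxq')).trans ?_
    rw [EReal.coe_le_coe_iff]; linarith
  have hxy : wdist H w x y ≤ (ρ : EReal) := by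
    refine (wdist_le_wlen hwH ((q.transfer H hedge).dropUntil x hxq')).trans ?_
    rw [EReal.coe_le_coe_iff]; linarith
  have hxD : x ∉ D := notMem_of_mem_support_del q hbD x hxq
  -- A source is a trunk vertex, so in an affected tree its component would be an affected subtree
  -- containing x.
  have hunaff : ∀ t : ℕ × V, t.1 = i → x ∈ (tree C ρ L t).verts → ¬ IsAffected C ρ L D t := by
    intro t hti hxt hta
    refine hun x hxq t _ (isAffectedSubtree_component hta hxt hxD ?_) (Reachable.refl x)
    rw [hti]; exact hxS
  obtain ⟨t, ht, hti, hxt, hbt⟩ := exists_tree_of_last_index (C := C) hn hw hi hxS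
    (hout b q.start_mem_support) hxb
  obtain ⟨t', ht', hti', hxt', hyt'⟩ := exists_tree_of_last_index (C := C) hn hw hi hxS
    (hout y q.end_mem_support) hxy
  exact ⟨t, ht, t', ht', x, hunaff t hti hxt, hunaff t' hti' hxt', hbt, hxt, hxt', hyt'⟩

/-- Jump from one marked vertex to the next: along an edge by E', across an unmarked stretch by
unaffected trees. -/
theorem reachable_of_walk (hn : 3 ≤ Fintype.card V) (hw : ∀ e ∈ G.edgeSet, 0 < w e)
    (hL : L.head? = some Finset.univ) (P : PathData C ρ L) {D : Finset V} {u v : V}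
    (n : ℕ) : ∀ {a : V} (q : (del G D).Walk a v), q.length ≤ n → wlen w q ≤ ρ → a ∉ D →
      ∀ N, IsRVertex C ρ L D u v N → a ∈ N.verts → (RGraph P D u v).Reachable N (.single v) := by
  have hwD : ∀ e ∈ (del G D).edgeSet, 0 < w e := pos_of_le (del_le G D) hw
  have hvR : IsRVertex C ρ L D u v (.single v) := Or.inr rfl
  induction n with
  | zero =>
    intro a q hqn _ _ N hN ha
    obtain rfl := Walk.eq_of_length_eq_zero (Nat.le_zero.1 hqn)
    exact reachable_of_eq_or_adj hw P hN hvR ha rfl (Or.inl rfl)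
  | succ n ih =>
    intro a q hqn hqρ haD N hN ha
    cases q with
    | nil => exact reachable_of_eq_or_adj hw P hN hvR ha rfl (Or.inl rfl)
    | @cons _ b _ hab q =>
      rw [wlen_cons] at hqρ
      have hab0 : 0 < w s(a, b) := hwD s(a, b) hab
      have hq0 := wlen_nonneg hwD q
      have hbD : b ∉ D := hab.2.2
      rw [Walk.length_cons] at hqn
      rcases exists_first_split (fun x => ∃ N, IsRVertex C ρ L D u v N ∧ x ∈ N.verts) q
        ⟨_, hvR, rfl⟩ with ⟨N', hN', hbN'⟩ | ⟨y, z, q₀, hyz, q₁, ⟨N', hN', hzN'⟩, hun, rfl⟩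
      · exact (reachable_of_eq_or_adj hw P hN hN' ha hbN' (Or.inr ⟨hab.1, by linarith⟩)).trans
          (ih q (by omega) (by linarith) hbD N' hN' hbN')
      · rw [wlen_append, wlen_cons] at hqρ
        rw [Walk.length_append, Walk.length_cons] at hqn
        have h0 := wlen_nonneg hwD q₀
        have h1 := wlen_nonneg hwD q₁
        have hyz0 : 0 < w s(y, z) := hwD s(y, z) hyz
        obtain ⟨t, ht, t', ht', x, hta, hta', hbt, hxt, hxt', hyt'⟩ :=
          exists_trees_of_unmarked (C := C) hn hw hL q₀ (by linarith) hbD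
            fun x hx t X hX hxX => hun x hx ⟨.sub t X, hX, hxX⟩
        refine (reachable_of_trees hw P hN hN' ha hzN' hab.1 (by linarith) hyz.1.symm ?_ ht ht'
          hta hta' hbt hxt hxt' hyt').trans
          (ih q₁ (by omega) (by linarith) hyz.2.2 N' hN' hzN')
        rw [Sym2.eq_swap]; linarith

theorem outputsYes_of_wdist_le (hn : 3 ≤ Fintype.card V) (hw : ∀ e ∈ G.edgeSet, 0 < w e)
    {c : ℝ} {d : ℕ} (O : Oracle G w c d ρ) {u v : V} {D : Finset V} (hu : u ∉ D)
    (huv : wdist (del G D) w u v ≤ (ρ : EReal)) : O.OutputsYes u v D := by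
  obtain ⟨p, -, hp⟩ := exists_path_of_wdist_le huv
  exact reachable_of_walk hn hw (queryPath_spec O.cover c d D).1 _ _
    (p : (del G D).Walk u v) le_rfl hp hu _ (Or.inl rfl) rfl

end Completeness

/-! ### The answer Yes gives short distances. -/

section Soundness

variable {V : Type*} [Fintype V] [DecidableEq V] {G : SimpleGraph V} {w : Sym2 V → ℝ}
  {C : Covers G w} {ρ : ℝ} {L : List (Finset V)}

omit [Fintype V] [DecidableEq V] in
theorem trunk_mono {T T' : G.Subgraph} (h : T ≤ T') (S : Finset V) : trunk T S ⊆ trunk T' S := by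
  rintro v ⟨a, haS, b, hbS, ha, hb, p, hv⟩
  refine ⟨a, haS, b, hbS, h.1 ha, h.1 hb,
    ⟨(p : T.spanningCoe.Walk a b).mapLe (Subgraph.spanningCoe_le_of_le h),
      (Walk.isPath_mapLe _).2 p.2⟩, ?_⟩
  simpa using hv

omit [DecidableEq V] in
theorem pdeg_mono {T T' : G.Subgraph} (h : T ≤ T') (S : Finset V) (v : V) :
    pdeg T S v ≤ pdeg T' S v :=
  Set.ncard_le_ncard (fun _ hx => ⟨trunk_mono h S hx.1, trunk_mono h S hx.2.1, h.2 hx.2.2⟩)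
    (Set.toFinite _)

theorem component_eq {D : Finset V} {t : ℕ × V} {x y : V} (h : y ∈ component C ρ L D t x) :
    component C ρ L D t x = component C ρ L D t y := by
  ext z
  exact ⟨fun hz => Reachable.trans (Reachable.symm h) hz, fun hz => Reachable.trans h hz⟩

theorem adj_deleteVerts {D : Finset V} {t : ℕ × V} {y f : V} (hy : y ∉ D) (hf : f ∉ D)
    (h : (tree C ρ L t).Adj y f) :
    ((tree C ρ L t).deleteVerts (D : Set V)).spanningCoe.Adj y f := by
  rw [Subgraph.spanningCoe_adj, Subgraph.deleteVerts_adj]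
  exact ⟨(tree C ρ L t).edge_vert h, by simpa using hy, (tree C ρ L t).edge_vert h.symm,
    by simpa using hf, h⟩

/-- A component of T - D can be left only into D, so the edge where the walk leaves X determines X
as the component of a trunk neighbour of some f ∈ D. -/
theorem exists_boundary_of_trunk_walk {D : Finset V} {t : ℕ × V} {X : Set V}
    (hX : IsAffectedSubtree C ρ L D t X) {z b : V}
    (q : (tree C ρ L t).spanningCoe.Walk z b) (hz : z ∈ X) (hb : b ∉ X)
    (hq : ∀ x ∈ q.support, x ∈ trunk (tree C ρ L t) (sources L t.1)) :
    ∃ f ∈ D, ∃ y, X = component C ρ L D t y ∧ f ∈ trunk (tree C ρ L t) (sources L t.1) ∧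
      y ∈ trunk (tree C ρ L t) (sources L t.1) ∧ (tree C ρ L t).Adj f y := by
  obtain ⟨⟨⟨y, f⟩, hyf⟩, hd, hy, hf⟩ := q.exists_boundary_dart X hz hb
  obtain ⟨-, ⟨x, hx, hxD, hXx⟩, -⟩ := id hX
  have hXx : X = component C ρ L D t x := hXx
  have hyf' : (tree C ρ L t).Adj y f := hyf
  simp only at hy hf
  have hfD : f ∈ D := by
    by_contra hfD
    refine hf ?_
    have hyD := (hX.subset hy).2
    rw [hXx] at hy ⊢
    exact Reachable.trans hy (adj_deleteVerts hyD hfD hyf').reachable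
  rw [hXx] at hy
  exact ⟨f, hfD, y, by rw [hXx, component_eq hy], hq _ (q.dart_snd_mem_support_of_mem_darts hd),
    hq _ (q.dart_fst_mem_support_of_mem_darts hd), hyf'.symm⟩

theorem tree_reachable (hw : ∀ e ∈ G.edgeSet, 0 < w e) {t : ℕ × V} (ht : t ∈ trees L) {a b : V}
    (ha : a ∈ (tree C ρ L t).verts) (hb : b ∈ (tree C ρ L t).verts) :
    (tree C ρ L t).spanningCoe.Reachable a b := by
  obtain ⟨p, -⟩ := exists_tree_walk hw C ρ ht ha
  obtain ⟨q, -⟩ := exists_tree_walk hw C ρ ht hb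
  exact ⟨p.reverse.append q⟩

open Classical in
-- The extra 1 is the component of a fixed source a₀. Any other affected subtree is left by some
-- trunk walk and is charged to a trunk edge at D.
theorem exists_finset_affectedSubtrees (hw : ∀ e ∈ G.edgeSet, 0 < w e) {D : Finset V}
    {t : ℕ × V} (ht : t ∈ trees L) :
    ∃ F : Finset (Set V), (∀ X, IsAffectedSubtree C ρ L D t X → X ∈ F) ∧
      F.card ≤ 1 + ∑ f ∈ D.filter (fun f => f ∈ (tree C ρ L t).verts),
        pdeg (tree C ρ L t) (sources L t.1) f := by
  set T := tree C ρ L t with hT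
  set S := sources L t.1 with hS
  by_cases hsrc : ∃ a₀ ∈ S, a₀ ∈ T.verts
  swap
  · refine ⟨∅, fun X hX => ?_, by simp⟩
    obtain ⟨-, -, z, -, a, haS, -, -, ha, -⟩ := hX
    exact absurd ⟨a, haS, ha⟩ hsrc
  obtain ⟨a₀, ha₀S, ha₀⟩ := hsrc
  let nb : V → Finset V := fun f =>
    Finset.univ.filter fun y => f ∈ trunk T S ∧ y ∈ trunk T S ∧ T.Adj f y
  have hnb : ∀ f, (nb f).card = pdeg T S f := fun f => by
    rw [← Set.ncard_coe_finset]; unfold pdeg; congr 1; ext; simp [nb]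
  refine ⟨insert (component C ρ L D t a₀) ((D.filter fun f => f ∈ T.verts).biUnion fun f =>
    (nb f).image fun y => component C ρ L D t y), fun X hX => ?_, ?_⟩
  · rw [Finset.mem_insert]
    by_cases hX₀ : a₀ ∈ X
    · left
      obtain ⟨-, ⟨x, -, -, hXx⟩, -⟩ := hX
      have hXx : X = component C ρ L D t x := hXx
      rw [hXx] at hX₀ ⊢
      exact component_eq hX₀
    right
    have hbd : ∃ f ∈ D, ∃ y, X = component C ρ L D t y ∧ f ∈ trunk T S ∧ y ∈ trunk T S ∧
        T.Adj f y := by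
      obtain ⟨-, -, z, hzX, a, haS, b, hbS, ha, hb, p, hzp⟩ := id hX
      -- If the source a lies in X, the path from a to a₀ leaves X; otherwise the trunk path from z
      -- back to a does.
      by_cases haX : a ∈ X
      · obtain ⟨q⟩ := tree_reachable (C := C) (ρ := ρ) hw ht ha ha₀
        exact exists_boundary_of_trunk_walk hX q.bypass haX hX₀ fun x hx =>
          ⟨a, haS, a₀, ha₀S, ha, ha₀, ⟨q.bypass, q.bypass_isPath⟩, hx⟩
      · refine exists_boundary_of_trunk_walk hX
          ((p : T.spanningCoe.Walk a b).takeUntil z hzp).reverse hzX haX fun x hx =>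
          ⟨a, haS, b, hbS, ha, hb, p, ?_⟩
        rw [Walk.support_reverse, List.mem_reverse] at hx
        exact (p : T.spanningCoe.Walk a b).support_takeUntil_subset_support hzp hx
    obtain ⟨f, hfD, y, rfl, hf, hy, hfy⟩ := hbd
    simp only [Finset.mem_biUnion, Finset.mem_filter, Finset.mem_image]
    exact ⟨f, ⟨hfD, trunk_subset_verts T S hf⟩, y, by simp [nb, hf, hy, hfy], rfl⟩
  · refine (Finset.card_insert_le _ _).trans ?_
    rw [add_comm]
    refine Nat.add_le_add_left (Finset.card_biUnion_le.trans ?_) 1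
    exact Finset.sum_le_sum fun f _ => Finset.card_image_le.trans (hnb f).le

theorem pdeg_le_threshold {c : ℝ} {d : ℕ} {D : Finset V} (hlow : LowDegreeAlong C c d D L)
    {t : ℕ × V} (ht : t ∈ trees L) {f : V} (hfD : f ∈ D) (hf : f ∈ (tree C ρ L t).verts) :
    (pdeg (tree C ρ L t) (sources L t.1) f : ℝ) ≤ threshold V c d := by
  refine le_trans (Nat.cast_le.2 (pdeg_mono (tree_le_fullTree C ρ L t) _ f)) ?_
  have h1 := hlow t.1 ht.1 f hfD
    ((C (L.getD (t.1 + 1) ∅) (L.getD t.1 ∅)).avoids t.2 ht.2 f hf.1)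
  by_contra! hcon
  refine h1 ?_
  simp only [Hi, Finset.mem_filter, Finset.mem_univ, true_and]
  exact ⟨t.2, ht.2, hcon⟩

open Classical in
-- An affected tree meets D, so |D ∩ T| ≥ 1 absorbs the extra component. The bound can then be
-- summed over all trees, unaffected ones contributing 0.
theorem exists_finset_affectedSubtrees' (hw : ∀ e ∈ G.edgeSet, 0 < w e) {c : ℝ} {d : ℕ}
    {D : Finset V} (hlow : LowDegreeAlong C c d D L) {t : ℕ × V} (ht : t ∈ trees L) :
    ∃ F : Finset (Set V), (∀ X, IsAffectedSubtree C ρ L D t X → X ∈ F) ∧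
      (F.card : ℝ) ≤ ((D.filter fun f => f ∈ (tree C ρ L t).verts).card : ℝ) *
        (1 + threshold V c d) := by
  set Dt := D.filter fun f => f ∈ (tree C ρ L t).verts with hDt
  rcases Dt.eq_empty_or_nonempty with he | hne
  · refine ⟨∅, fun X hX => ?_, by simp [he]⟩
    obtain ⟨⟨-, x, hx, hxD⟩, -⟩ := hX
    have : x ∈ Dt := Finset.mem_filter.2 ⟨hxD, hx⟩
    simp [he] at this
  · obtain ⟨F, hF, hcard⟩ := exists_finset_affectedSubtrees (C := C) (ρ := ρ) hw (D := D) ht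
    refine ⟨F, hF, ?_⟩
    have h1 : (F.card : ℝ) ≤ 1 + ∑ f ∈ Dt, (pdeg (tree C ρ L t) (sources L t.1) f : ℝ) := by
      exact_mod_cast hcard
    have h2 : ∑ f ∈ Dt, (pdeg (tree C ρ L t) (sources L t.1) f : ℝ)
        ≤ Dt.card * threshold V c d := by
      rw [← nsmul_eq_mul]
      exact Finset.sum_le_card_nsmul _ _ _ fun f hf =>
        pdeg_le_threshold hlow ht (Finset.mem_filter.1 hf).1 (Finset.mem_filter.1 hf).2
    have h3 : (1 : ℝ) ≤ Dt.card := by exact_mod_cast hne.card_pos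
    linarith

open Classical in
theorem card_trees_through_le (hn : 3 ≤ Fintype.card V) (f : V) :
    (((finite_trees L).toFinset.filter fun t => f ∈ (tree C ρ L t).verts).card : ℝ)
      ≤ L.length * (Real.exp 1 * kpar V * (kpar V + 1)) := by
  let Sf : ℕ → Finset V := fun i => Finset.univ.filter fun x => x ∈ sources L i ∧
    f ∈ ((C (L.getD (i + 1) ∅) (L.getD i ∅)).tree x).verts
  have h1 : (finite_trees L).toFinset.filter (fun t => f ∈ (tree C ρ L t).verts) ⊆
      (Finset.range L.length).biUnion fun i => (Sf i).image fun x => (i, x) := by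
    rintro ⟨i, x⟩ ht
    simp only [Finset.mem_filter, Set.Finite.mem_toFinset] at ht
    simp only [Finset.mem_biUnion, Finset.mem_range, Finset.mem_image]
    exact ⟨i, ht.1.1, x, by simpa [Sf] using ⟨ht.1.2, ht.2.1⟩, rfl⟩
  have h2 := (Finset.card_le_card h1).trans Finset.card_biUnion_le
  have h3 : ∀ i, ((Sf i).card : ℝ) ≤ Real.exp 1 * kpar V * (kpar V + 1) := fun i => by
    refine le_trans (le_of_eq ?_) (overlap_le hn (C (L.getD (i + 1) ∅) (L.getD i ∅)) f)
    rw [← Set.ncard_coe_finset]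
    congr 2
    ext x
    simp [Sf, sources]
  calc _ ≤ ∑ i ∈ Finset.range L.length, (((Sf i).image fun x => (i, x)).card : ℝ) := by
          exact_mod_cast h2
    _ ≤ _ := by
      refine (Finset.sum_le_card_nsmul _ _ _ fun i _ => ?_).trans
        (le_of_eq (by rw [Finset.card_range, nsmul_eq_mul]))
      exact le_trans (Nat.cast_le.2 Finset.card_image_le) (h3 i)

open Classical in
theorem exists_finset_RVertex (hn : 3 ≤ Fintype.card V) (hw : ∀ e ∈ G.edgeSet, 0 < w e) {c : ℝ}
    {d : ℕ} {D : Finset V} (hlow : LowDegreeAlong C c d D L) (hs : 0 ≤ threshold V c d)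
    (u v : V) :
    ∃ F : Finset (RNode V), (∀ N, IsRVertex C ρ L D u v N → N ∈ F) ∧
      (F.card : ℝ) ≤ 2 + D.card * L.length * (Real.exp 1 * kpar V * (kpar V + 1)) *
        (1 + threshold V c d) := by
  choose! F hF hFc using fun t (ht : t ∈ trees L) =>
    exists_finset_affectedSubtrees' (C := C) (ρ := ρ) hw hlow ht
  set TF := (finite_trees L).toFinset with hTF
  have hmem : ∀ t, t ∈ TF ↔ t ∈ trees L := fun t => by simp [hTF]
  refine ⟨{.single u, .single v} ∪ TF.biUnion fun t => (F t).image (RNode.sub t), ?_, ?_⟩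
  · rintro (x | ⟨t, X⟩) hN
    · rcases hN with rfl | rfl <;> simp
    · refine Finset.mem_union_right _ (Finset.mem_biUnion.2 ⟨t, (hmem t).2 hN.1.1, ?_⟩)
      exact Finset.mem_image_of_mem _ (hF t hN.1.1 X hN)
  · have h1 : (((TF.biUnion fun t => (F t).image (RNode.sub t)).card : ℕ) : ℝ)
        ≤ ∑ t ∈ TF, ((D.filter fun f => f ∈ (tree C ρ L t).verts).card : ℝ) *
          (1 + threshold V c d) := by
      refine (Nat.cast_le.2 Finset.card_biUnion_le).trans ?_
      push_cast
      refine Finset.sum_le_sum fun t ht => ?_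
      exact le_trans (Nat.cast_le.2 Finset.card_image_le) (hFc t ((hmem t).1 ht))
    have h2 : ∑ t ∈ TF, ((D.filter fun f => f ∈ (tree C ρ L t).verts).card : ℝ)
        = ∑ f ∈ D, ((TF.filter fun t => f ∈ (tree C ρ L t).verts).card : ℝ) := by
      simp only [Finset.card_filter]
      push_cast
      exact Finset.sum_comm
    have h3 : ∑ f ∈ D, ((TF.filter fun t => f ∈ (tree C ρ L t).verts).card : ℝ)
        ≤ D.card * (L.length * (Real.exp 1 * kpar V * (kpar V + 1))) := by
      rw [← nsmul_eq_mul]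
      exact Finset.sum_le_card_nsmul _ _ _ fun f _ => card_trees_through_le hn f
    rw [← Finset.sum_mul, h2] at h1
    have h4 := h1.trans (mul_le_mul_of_nonneg_right h3 (by linarith))
    have h5 : ((({.single u, .single v} : Finset (RNode V)).card : ℕ) : ℝ) ≤ 2 := by
      exact_mod_cast Finset.card_le_two
    refine (Nat.cast_le.2 (Finset.card_union_le _ _)).trans ?_
    push_cast
    linarith

theorem wdist_tree_le (hw : ∀ e ∈ G.edgeSet, 0 < w e) {D : Finset V} {t : ℕ × V}
    (ht : t ∈ trees L) (hta : ¬ IsAffected C ρ L D t) {a b : V}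
    (ha : a ∈ (tree C ρ L t).verts) (hb : b ∈ (tree C ρ L t).verts) :
    wdist (del G D) w a b ≤ ((2 * ((2 * kpar V - 1) * ρ) : ℝ) : EReal) := by
  obtain ⟨p, hp⟩ := exists_tree_walk hw C ρ ht ha
  obtain ⟨q, hq⟩ := exists_tree_walk hw C ρ ht hb
  have hD : ∀ x ∈ (tree C ρ L t).verts, x ∉ D := fun x hx hxD => hta ⟨ht, x, hx, hxD⟩
  have hle : (tree C ρ L t).spanningCoe ≤ del G D := fun x y hxy =>
    ⟨(tree C ρ L t).adj_sub hxy, hD x ((tree C ρ L t).edge_vert hxy),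
      hD y ((tree C ρ L t).edge_vert (Subgraph.Adj.symm hxy))⟩
  refine (wdist_le_wlen (pos_of_le (del_le G D) hw) ((p.reverse.append q).mapLe hle)).trans ?_
  rw [wlen_mapLe, wlen_append, wlen_reverse, EReal.coe_le_coe_iff]
  linarith

/-- The root may lie outside X, but paths in a tree are unique: the path inside X is the shortcut of
the walk through the root of T. -/
theorem wdist_subtree_le (hw : ∀ e ∈ G.edgeSet, 0 < w e) {D : Finset V} {t : ℕ × V} {X : Set V}
    (hX : IsAffectedSubtree C ρ L D t X) {a b : V} (ha : a ∈ X) (hb : b ∈ X) :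
    wdist (del G D) w a b ≤ ((2 * ((2 * kpar V - 1) * ρ) : ℝ) : EReal) := by
  have ht : t ∈ trees L := hX.1.1
  obtain ⟨p, hp⟩ := exists_tree_walk hw C ρ ht (hX.subset ha).1
  obtain ⟨q, hq⟩ := exists_tree_walk hw C ρ ht (hX.subset hb).1
  obtain ⟨-, ⟨x, -, -, rfl⟩, -⟩ := hX
  obtain ⟨r⟩ : ((tree C ρ L t).deleteVerts (D : Set V)).spanningCoe.Reachable a b :=
    Reachable.trans (Reachable.symm ha) hb
  have hleT : ((tree C ρ L t).deleteVerts (D : Set V)).spanningCoe ≤ (tree C ρ L t).spanningCoe :=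
    Subgraph.spanningCoe_le_of_le Subgraph.deleteVerts_le
  have hleD : ((tree C ρ L t).deleteVerts (D : Set V)).spanningCoe ≤ del G D := by
    intro x y hxy
    rw [Subgraph.spanningCoe_adj, Subgraph.deleteVerts_adj] at hxy
    exact ⟨Subgraph.adj_sub _ hxy.2.2.2.2, by simpa using hxy.2.1, by simpa using hxy.2.2.2.1⟩
  have huniq := (isAcyclic_iff_subsingleton_path.1 (tree_spanningCoe_isAcyclic C ρ ht) a b).elim
    ⟨r.bypass.mapLe hleT, (Walk.isPath_mapLe _).2 r.bypass_isPath⟩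
    ⟨(p.reverse.append q).bypass, Walk.bypass_isPath _⟩
  have h1 : wlen w r.bypass = wlen w (p.reverse.append q).bypass := by
    rw [← wlen_mapLe hleT]
    exact congrArg (wlen w) (congrArg Subtype.val huniq)
  have h2 := wlen_bypass_le (spanningCoe_pos hw _) (p.reverse.append q)
  rw [wlen_append, wlen_reverse] at h2
  refine (wdist_le_wlen (pos_of_le (del_le G D) hw) (r.bypass.mapLe hleD)).trans ?_
  rw [wlen_mapLe, EReal.coe_le_coe_iff]
  linarith

theorem wdist_RNode_le (hn : 3 ≤ Fintype.card V) (hw : ∀ e ∈ G.edgeSet, 0 < w e) (hρ : 0 ≤ ρ)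
    {D : Finset V} {u v : V} {N : RNode V} (hN : IsRVertex C ρ L D u v N) {a b : V}
    (ha : a ∈ N.verts) (hb : b ∈ N.verts) :
    wdist (del G D) w a b ≤ ((2 * ((2 * kpar V - 1) * ρ) : ℝ) : EReal) := by
  cases N with
  | single x =>
    obtain rfl : a = x := ha
    obtain rfl : b = a := hb
    rw [wdist_self (pos_of_le (del_le G D) hw)]
    have hk := one_lt_kpar hn
    have : 0 ≤ 2 * ((2 * kpar V - 1) * ρ) := by
      have := mul_nonneg (by linarith : 0 ≤ 2 * kpar V - 1) hρ
      linarith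
    exact_mod_cast this
  | sub t X => exact wdist_subtree_le hw hN ha hb

theorem notMem_of_mem_RNode {D : Finset V} {u v : V} (hu : u ∉ D) (hv : v ∉ D) {N : RNode V}
    (hN : IsRVertex C ρ L D u v N) {a : V} (ha : a ∈ N.verts) : a ∉ D := by
  cases N with
  | single x =>
    obtain rfl : a = x := ha
    rcases hN with rfl | rfl
    · exact hu
    · exact hv
  | sub t X => exact (IsAffectedSubtree.subset hN ha).2

theorem mem_verts_of_mem_interval (P : PathData C ρ L) {D : Finset V} {u v : V} {N : RNode V}
    (hN : IsRVertex C ρ L D u v N) {I : Finset ℕ} (hI : I ∈ P.intervals N) {q : ℕ} (hq : q ∈ I)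
    {t : ℕ × V} {x : V} (hx : P.Λ[q]? = some (t, x)) : x ∈ N.verts := by
  cases N with
  | single y =>
    obtain rfl : I = {P.occ y} := by simpa [PathData.intervals] using hI
    obtain rfl : q = P.occ y := by simpa using hq
    obtain ⟨s, hs⟩ := P.occ_spec y
    rw [PathData.Λ, hs] at hx
    simp only [Option.some.injEq, Prod.mk.injEq] at hx
    exact hx.2.symm
  | sub s X =>
    obtain ⟨y, hy, hy'⟩ := (P.rep_union s hN.1.1 X
      (fun y hy => (IsAffectedSubtree.subset hN hy).1) q).1 ⟨I, hI, hq⟩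
    rw [PathData.Λ, hy'] at hx
    simp only [Option.some.injEq, Prod.mk.injEq] at hx
    rw [← hx.2]
    exact hy

omit [Fintype V] [DecidableEq V] in
theorem wdist_le_of_adj (hw : ∀ e ∈ G.edgeSet, 0 < w e) {D : Finset V} {x y : V}
    (hx : x ∉ D) (hy : y ∉ D) (hxy : G.Adj x y) (h : w s(x, y) ≤ ρ) :
    wdist (del G D) w x y ≤ (ρ : EReal) := by
  have hadj : (del G D).Adj x y := ⟨hxy, hx, hy⟩
  refine (wdist_le_wlen (pos_of_le (del_le G D) hw) (Walk.cons hadj Walk.nil)).trans ?_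
  rw [EReal.coe_le_coe_iff]
  simpa [wlen] using h

/-- H is layered, so such a path has exactly four edges. -/
theorem ReachesAvoiding.exists_trees {P : PathData C ρ L} {D : Finset V} {I J : Finset ℕ}
    (h : ReachesAvoiding P D (.int1 I) (.int2 J)) :
    ∃ t ∈ trees L, ∃ t' ∈ trees L, ∃ z, ¬ IsAffected C ρ L D t ∧ ¬ IsAffected C ρ L D t' ∧
      Linked P I t ∧ z ∈ (tree C ρ L t).verts ∧ z ∈ (tree C ρ L t').verts ∧ Linked P J t' := by
  rcases Relation.ReflTransGen.cases_head h with h | ⟨_, ⟨h₁, ha₁⟩, h⟩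
  · cases h
  cases h₁ with
  | enter _ t _ ht hlink =>
  rcases Relation.ReflTransGen.cases_head h with h | ⟨_, ⟨h₂, -⟩, h⟩
  · cases h
  cases h₂ with
  | up _ z _ hz =>
  rcases Relation.ReflTransGen.cases_head h with h | ⟨_, ⟨h₃, ha₃⟩, h⟩
  · cases h
  cases h₃ with
  | down t' _ ht' hz' =>
  rcases Relation.ReflTransGen.cases_head h with h | ⟨_, ⟨h₄, -⟩, h⟩
  · cases h
  cases h₄ with
  | leave J' _ _ _ hlink' =>
  rcases Relation.ReflTransGen.cases_head h with h | ⟨_, ⟨h₅, -⟩, -⟩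
  · cases h
    exact ⟨t, ht, t', ht', z, fun hta => (ha₁ t hta).2.2.1 rfl,
      fun hta => (ha₃ t' hta).2.2.2 rfl, hlink, hz, hz', hlink'⟩
  · cases h₅

theorem exists_wdist_le_of_rel (hn : 3 ≤ Fintype.card V) (hw : ∀ e ∈ G.edgeSet, 0 < w e)
    (hρ : 0 ≤ ρ) (P : PathData C ρ L) {D : Finset V} {u v : V} (hu : u ∉ D) (hv : v ∉ D)
    {N N' : RNode V} (hN : IsRVertex C ρ L D u v N) (hN' : IsRVertex C ρ L D u v N')
    {I J : Finset ℕ} (hI : I ∈ P.intervals N) (hJ : J ∈ P.intervals N')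
    (h : ReachesAvoiding P D (.int1 I) (.int2 J) ∨ ∃ q ∈ I, ∃ q' ∈ J, (q, q') ∈ ETable P) :
    ∃ x ∈ N.verts, ∃ y ∈ N'.verts,
      wdist (del G D) w x y ≤ ((4 * ((2 * kpar V - 1) * ρ) + 2 * ρ : ℝ) : EReal) := by
  have hwD : ∀ e ∈ (del G D).edgeSet, 0 < w e := pos_of_le (del_le G D) hw
  have hB : 0 ≤ (2 * kpar V - 1) * ρ := by
    have := one_lt_kpar hn
    exact mul_nonneg (by linarith) hρ
  rcases h with h | ⟨q, hq, q', hq', s, x, s', y, hx, hy, hxy⟩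
  · obtain ⟨t, ht, t', ht', z, hta, hta', ⟨x, a, ⟨q, hq, s, hx⟩, ha, hxa, hxa'⟩, hz, hz',
      ⟨y, b, ⟨q', hq', s', hy⟩, hb, hyb, hyb'⟩⟩ := h.exists_trees
    have hxN := mem_verts_of_mem_interval P hN hI hq hx
    have hyN := mem_verts_of_mem_interval P hN' hJ hq' hy
    have haD : a ∉ D := fun h => hta ⟨ht, a, ha, h⟩
    have hbD : b ∉ D := fun h => hta' ⟨ht', b, hb, h⟩
    refine ⟨x, hxN, y, hyN, ?_⟩
    have h1 := wdist_le_of_adj hw (notMem_of_mem_RNode hu hv hN hxN) haD hxa hxa'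
    have h2 := wdist_tree_le hw ht hta ha hz
    have h3 := wdist_tree_le hw ht' hta' hz' hb
    have h4 := wdist_le_of_adj hw (notMem_of_mem_RNode hu hv hN' hyN) hbD hyb hyb'
    rw [wdist_comm] at h4
    refine (wdist_triangle_le hwD (wdist_triangle_le hwD (wdist_triangle_le hwD h1 h2) h3)
      h4).trans ?_
    rw [EReal.coe_le_coe_iff]
    linarith
  · have hxN := mem_verts_of_mem_interval P hN hI hq hx
    have hyN := mem_verts_of_mem_interval P hN' hJ hq' hy
    refine ⟨x, hxN, y, hyN, ?_⟩
    rcases hxy with rfl | ⟨hadj, hle⟩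
    · rw [wdist_self hwD, ← EReal.coe_zero, EReal.coe_le_coe_iff]
      linarith
    · refine (wdist_le_of_adj hw (notMem_of_mem_RNode hu hv hN hxN)
        (notMem_of_mem_RNode hu hv hN' hyN) hadj hle).trans ?_
      rw [EReal.coe_le_coe_iff]
      linarith

theorem isRVertex_of_adj {P : PathData C ρ L} {D : Finset V} {u v : V} {N N' : RNode V}
    (h : (RGraph P D u v).Adj N N') : IsRVertex C ρ L D u v N ∧ IsRVertex C ρ L D u v N' := by
  obtain ⟨-, h | h⟩ := (SimpleGraph.fromRel_adj _ _ _).1 h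
  · exact ⟨h.1, h.2.1⟩
  · exact ⟨h.2.1, h.1⟩

theorem exists_wdist_le_of_RGraph_adj (hn : 3 ≤ Fintype.card V) (hw : ∀ e ∈ G.edgeSet, 0 < w e)
    (hρ : 0 ≤ ρ) (P : PathData C ρ L) {D : Finset V} {u v : V} (hu : u ∉ D) (hv : v ∉ D)
    {N N' : RNode V} (h : (RGraph P D u v).Adj N N') {x : V} (hx : x ∈ N.verts) :
    ∃ y ∈ N'.verts, wdist (del G D) w x y ≤ ((12 * kpar V * ρ : ℝ) : EReal) := by
  have hwD : ∀ e ∈ (del G D).edgeSet, 0 < w e := pos_of_le (del_le G D) hw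
  obtain ⟨hN, hN'⟩ := isRVertex_of_adj h
  have key : ∃ a ∈ N.verts, ∃ y ∈ N'.verts,
      wdist (del G D) w a y ≤ ((4 * ((2 * kpar V - 1) * ρ) + 2 * ρ : ℝ) : EReal) := by
    obtain ⟨-, ⟨-, -, I, hI, J, hJ, h⟩ | ⟨-, -, I, hI, J, hJ, h⟩⟩ :=
      (SimpleGraph.fromRel_adj _ _ _).1 h
    · exact exists_wdist_le_of_rel hn hw hρ P hu hv hN hN' hI hJ h
    · obtain ⟨y, hy, a, ha, hle⟩ := exists_wdist_le_of_rel hn hw hρ P hu hv hN' hN hI hJ h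
      exact ⟨a, ha, y, hy, by rwa [wdist_comm]⟩
  obtain ⟨a, ha, y, hy, hle⟩ := key
  -- Crossing the node and then the edge costs 6(2k - 1)ρ + 2ρ = 12kρ - 4ρ.
  refine ⟨y, hy, (wdist_triangle_le hwD (wdist_RNode_le hn hw hρ hN hx ha) hle).trans ?_⟩
  rw [EReal.coe_le_coe_iff]
  linarith

theorem wdist_le_of_RGraph_walk (hn : 3 ≤ Fintype.card V) (hw : ∀ e ∈ G.edgeSet, 0 < w e)
    (hρ : 0 ≤ ρ) (P : PathData C ρ L) {D : Finset V} {u v : V} (hu : u ∉ D) (hv : v ∉ D)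
    {N N' : RNode V} (p : (RGraph P D u v).Walk N N') {x : V} (hx : x ∈ N.verts)
    (hN' : N' = .single v) :
    wdist (del G D) w x v ≤ ((p.length * (12 * kpar V * ρ) : ℝ) : EReal) := by
  have hwD : ∀ e ∈ (del G D).edgeSet, 0 < w e := pos_of_le (del_le G D) hw
  induction p generalizing x with
  | nil =>
    subst hN'
    obtain rfl : x = v := hx
    simp [wdist_self hwD]
  | cons h p ih =>
    obtain ⟨y, hy, hxy⟩ := exists_wdist_le_of_RGraph_adj hn hw hρ P hu hv h hx
    refine (wdist_triangle_le hwD hxy (ih hy hN')).trans (le_of_eq ?_)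
    rw [Walk.length_cons]
    congr 1
    push_cast
    ring

theorem wdist_le_of_outputsYes (hn : 3 ≤ Fintype.card V) (hw : ∀ e ∈ G.edgeSet, 0 < w e)
    (hρ : 0 ≤ ρ) {c : ℝ} (hc : 1 ≤ c) {d : ℕ} (hd : 2 ≤ d) (O : Oracle G w c d ρ) {u v : V}
    {D : Finset V} (hD : D.card ≤ d) (hu : u ∉ D) (hv : v ∉ D) (h : O.OutputsYes u v D) :
    wdist (del G D) w u v ≤ (((1 + D.card * (depthBound V c d + 1 : ℕ) *
      (Real.exp 1 * kpar V * (kpar V + 1)) * (1 + threshold V c d)) * (12 * kpar V * ρ) : ℝ) :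
        EReal) := by
  classical
  have hk := one_lt_kpar hn
  have hE : 0 ≤ Real.exp 1 * kpar V * (kpar V + 1) := by
    have := Real.exp_pos 1
    have : 0 < kpar V := by linarith
    positivity
  have hs : 0 ≤ threshold V c d := by
    have h1 := two_le_threshold (V := V) hn hc hd
    have h2 := four_le_rpow_nat hd hc
    have h3 : 0 ≤ 2 * (Real.exp 1 * kpar V * (kpar V + 1)) * (d : ℝ) ^ (c + 1) :=
      mul_nonneg (by linarith) (by linarith)
    linarith
  set P := O.data (queryPath O.cover c d D) (queryPath_spec O.cover c d D) with hP
  have hreach : (RGraph P D u v).Reachable (.single u) (.single v) := h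
  obtain ⟨p, hp⟩ := hreach.exists_isPath
  obtain ⟨F, hF, hFc⟩ := exists_finset_RVertex (C := O.cover) (ρ := ρ) hn hw
    (lowDegreeAlong_queryPath hn hc hd O.cover hD) hs u v
  have hsup : ∀ N ∈ p.support, N ∈ F := by
    intro N hN
    refine hF N ?_
    by_cases hnil : p.Nil
    · rw [Walk.nil_iff_support_eq.1 hnil, List.mem_singleton] at hN
      subst hN
      exact Or.inl rfl
    · obtain ⟨e, he, hNe⟩ := (Walk.mem_support_iff_exists_mem_edges_of_not_nil hnil).1 hN
      induction e with
      | _ a b =>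
        have hab := isRVertex_of_adj (p.adj_of_mem_edges he)
        rcases Sym2.mem_iff.1 hNe with rfl | rfl
        · exact hab.1
        · exact hab.2
  -- A simple path has one edge fewer than vertices, which turns the 2 of the count into 1.
  have hlen : p.length + 1 ≤ F.card := by
    rw [← Walk.length_support, ← List.toFinset_card_of_nodup hp.support_nodup]
    exact Finset.card_le_card fun N hN => hsup N (List.mem_toFinset.1 hN)
  have hlen' : (p.length : ℝ) + 1 ≤ F.card := by exact_mod_cast hlen
  have hLl : ((queryPath O.cover c d D).length : ℝ) ≤ (depthBound V c d + 1 : ℕ) := by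
    exact_mod_cast length_queryPath_le O.cover c d D
  refine (wdist_le_of_RGraph_walk hn hw hρ P hu hv p (x := u) rfl rfl).trans ?_
  rw [EReal.coe_le_coe_iff]
  refine mul_le_mul_of_nonneg_right ?_ (mul_nonneg (by linarith) hρ)
  have h1 : (D.card : ℝ) * (queryPath O.cover c d D).length *
      (Real.exp 1 * kpar V * (kpar V + 1)) * (1 + threshold V c d) ≤
      D.card * (depthBound V c d + 1 : ℕ) *
      (Real.exp 1 * kpar V * (kpar V + 1)) * (1 + threshold V c d) := by
    refine mul_le_mul_of_nonneg_right (mul_le_mul_of_nonneg_right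
      (mul_le_mul_of_nonneg_left hLl (Nat.cast_nonneg _)) hE) (by linarith)
  linarith

end Soundness

/-! ### The final constant. -/

section Arithmetic

variable {V : Type*} [Fintype V]

theorem card_mul_depth_le (hn : 3 ≤ Fintype.card V) {c : ℝ} (hc : 1 ≤ c) {d : ℕ} (hd : 2 ≤ d)
    {D : Finset V} (hD : D.card ≤ d) :
    (D.card : ℝ) * (depthBound V c d + 1 : ℕ) ≤ 2 * (d * (kpar V / Real.log d)) := by
  have hk := one_lt_kpar hn
  have hd1 : (1 : ℝ) < d := by exact_mod_cast (by omega : 1 < d)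
  have hlogd : 0 < Real.log d := Real.log_pos hd1
  have hDd : (D.card : ℝ) ≤ d := by exact_mod_cast hD
  have hn3 : (3 : ℝ) ≤ Fintype.card V := by exact_mod_cast hn
  have hb : (1 / c) * Real.logb d (Fintype.card V) ≤ kpar V / Real.log d := by
    have h0 : 0 ≤ kpar V / Real.log d := by positivity
    have h1 : 1 / c ≤ 1 := by rw [div_le_one (by linarith)]; exact hc
    exact (mul_le_mul_of_nonneg_right h1 h0).trans (one_mul _).le
  set h := kpar V / Real.log d with hh
  have hh0 : 0 ≤ h := by positivity
  rcases le_or_gt (d : ℝ) (Fintype.card V) with hle | hlt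
  · have hh1 : 1 ≤ h := by
      rw [hh, one_le_div hlogd]
      exact Real.log_le_log (by linarith) hle
    have hp : ((depthBound V c d + 1 : ℕ) : ℝ) ≤ 2 * h := by
      have : (depthBound V c d : ℝ) ≤ h := by
        unfold depthBound
        rcases le_or_gt 0 ((1 / c) * Real.logb d (Fintype.card V)) with h1 | h1
        · exact (Nat.floor_le h1).trans hb
        · rw [Nat.floor_of_nonpos h1.le]; simpa using hh0
      push_cast
      linarith
    calc (D.card : ℝ) * (depthBound V c d + 1 : ℕ) ≤ d * (2 * h) :=
          mul_le_mul hDd hp (Nat.cast_nonneg _) (by linarith)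
      _ = _ := by ring
  -- For d > n the bound |D| ≤ d is too weak. Instead |D| ≤ n ≤ d·ln n / ln d, since ln x / x
  -- decreases beyond e.
  · have hh1 : h < 1 := by
      rw [hh, div_lt_one hlogd]
      exact Real.log_lt_log (by linarith) hlt
    have h0 : depthBound V c d = 0 := Nat.floor_eq_zero.2 (hb.trans_lt hh1)
    have hDn : (D.card : ℝ) ≤ Fintype.card V := by exact_mod_cast D.card_le_univ
    have he := Real.exp_one_lt_d9
    have h1 := Real.log_div_self_antitoneOn (a := (Fintype.card V : ℝ)) (b := (d : ℝ))
      (by rw [Set.mem_Ici]; linarith) (by rw [Set.mem_Ici]; linarith) hlt.le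
    simp only at h1
    rw [div_le_div_iff₀ (by linarith) (by linarith)] at h1
    have h2 : (Fintype.card V : ℝ) ≤ d * h := by
      rw [hh, ← mul_div_assoc, le_div_iff₀ hlogd]
      change _ ≤ (d : ℝ) * Real.log (Fintype.card V)
      linarith
    have h3 : 0 ≤ (d : ℝ) * h := by positivity
    rw [h0]
    push_cast
    linarith

/-- The five logarithms are two from the overlap, two from s and one from the step cost. The
constant 20e² is the product of 2, 2e and 5e from the bounds on |D|·p, the overlap and 1 + s. -/
theorem stretch_bound (hn : 3 ≤ Fintype.card V) {c : ℝ} (hc : 1 ≤ c) {d : ℕ} (hd : 2 ≤ d)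
    {D : Finset V} (hD : D.card ≤ d) :
    (1 + D.card * (depthBound V c d + 1 : ℕ) * (Real.exp 1 * kpar V * (kpar V + 1)) *
      (1 + threshold V c d)) * (12 * kpar V) ≤
    12 * (1 + 20 * Real.exp 1 ^ 2) * ((d : ℝ) ^ (c + 2)
      * (Real.logb 2 (Fintype.card V) / Real.logb 2 d) * Real.logb 2 (Fintype.card V) ^ 5) := by
  have hk := one_lt_kpar hn
  have hk0 : 0 < kpar V := by linarith
  have hd1 : (1 : ℝ) < d := by exact_mod_cast (by omega : 1 < d)
  have hlogd : 0 < Real.log d := Real.log_pos hd1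
  have he := Real.exp_one_gt_d9
  have hx4 := four_le_rpow_nat hd hc
  have hlog2 : 0 < Real.log 2 := Real.log_pos (by norm_num)
  have hratio : Real.logb 2 (Fintype.card V) / Real.logb 2 d = kpar V / Real.log d := by
    unfold Real.logb kpar
    field_simp
  have hpow : (d : ℝ) ^ (c + 2) = d * (d : ℝ) ^ (c + 1) := by
    rw [show c + 2 = c + 1 + 1 by ring, Real.rpow_add_one (by linarith : (d : ℝ) ≠ 0)]
    ring
  have hlk : kpar V ≤ Real.logb 2 (Fintype.card V) := by
    unfold Real.logb
    rw [le_div_iff₀ hlog2]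
    have h2 : Real.log 2 ≤ 1 := by have := Real.log_two_lt_d9; linarith
    change kpar V * Real.log 2 ≤ kpar V
    nlinarith
  have hth : 1 + threshold V c d ≤ 5 * Real.exp 1 * (d : ℝ) ^ (c + 1) * kpar V ^ 2 := by
    change 1 + (4 * Real.exp 1 * (d : ℝ) ^ (c + 1) * kpar V ^ 2 + 1) ≤ _
    have h1 : (1 : ℝ) ≤ kpar V ^ 2 := by nlinarith
    have h2 : (2 : ℝ) ≤ Real.exp 1 * (d : ℝ) ^ (c + 1) := by nlinarith
    nlinarith
  have hth0 : 0 ≤ 1 + threshold V c d := by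
    change 0 ≤ 1 + (4 * Real.exp 1 * (d : ℝ) ^ (c + 1) * kpar V ^ 2 + 1)
    have : 0 < (d : ℝ) ^ (c + 1) := by linarith
    positivity
  have hE : Real.exp 1 * kpar V * (kpar V + 1) ≤ 2 * Real.exp 1 * kpar V ^ 2 := by
    have : kpar V + 1 ≤ 2 * kpar V := by linarith
    have := mul_le_mul_of_nonneg_left this (by positivity : 0 ≤ Real.exp 1 * kpar V)
    nlinarith
  have hdh := card_mul_depth_le hn hc hd hD
  have hdh1 : 1 ≤ d * (kpar V / Real.log d) := by
    rw [← mul_div_assoc, one_le_div hlogd]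
    have := Real.log_le_sub_one_of_pos (by linarith : (0 : ℝ) < d)
    nlinarith
  rw [hratio, hpow]
  set dh := (d : ℝ) * (kpar V / Real.log d) with hdh_def
  set x := (d : ℝ) ^ (c + 1)
  set k := kpar V
  set l := Real.logb 2 (Fintype.card V : ℝ)
  have hmain : (D.card : ℝ) * (depthBound V c d + 1 : ℕ) * (Real.exp 1 * k * (k + 1)) *
      (1 + threshold V c d) ≤ 2 * dh * (2 * Real.exp 1 * k ^ 2) * (5 * Real.exp 1 * x * k ^ 2) :=
    mul_le_mul (mul_le_mul hdh hE (by positivity) (by positivity)) hth hth0 (by positivity)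
  have hone : 1 ≤ dh * x * k ^ 4 := by
    have h1 : 1 ≤ dh * x := by nlinarith
    have h2 : 1 ≤ k ^ 4 := one_le_pow₀ (by linarith)
    nlinarith
  have hk5 : k ^ 5 ≤ l ^ 5 := pow_le_pow_left₀ hk0.le hlk 5
  calc _ ≤ (dh * x * k ^ 4 + 2 * dh * (2 * Real.exp 1 * k ^ 2) * (5 * Real.exp 1 * x * k ^ 2))
        * (12 * k) := mul_le_mul_of_nonneg_right (add_le_add hone hmain) (by positivity)
    _ = 12 * (1 + 20 * Real.exp 1 ^ 2) * (dh * x) * k ^ 5 := by ring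
    _ ≤ 12 * (1 + 20 * Real.exp 1 ^ 2) * (dh * x) * l ^ 5 :=
        mul_le_mul_of_nonneg_left hk5 (by positivity)
    _ = _ := by rw [hdh_def]; ring

end Arithmetic

end VSDO

theorem mainTheorem7 (c : ℝ) (hc : 1 ≤ c) :
    ∃ K : ℝ, 0 < K ∧
      ∀ (V : Type*) [Fintype V] [DecidableEq V] (G : SimpleGraph V) (w : Sym2 V → ℝ)
        (d : ℕ) (ρ A : ℝ),
        3 ≤ Fintype.card V → 2 ≤ d → 0 ≤ ρ → (∀ e ∈ G.edgeSet, 0 < w e) →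
        A = K * ((d : ℝ) ^ (c + 2)
              * (Real.logb 2 (Fintype.card V) / Real.logb 2 d)
              * Real.logb 2 (Fintype.card V) ^ 5) →
        Nonempty (VSDO.Oracle G w c d ρ) ∧
        ∀ (O : VSDO.Oracle G w c d ρ) (u v : V) (D : Finset V),
          D.card ≤ d → u ∉ D → v ∉ D →
          (VSDO.wdist (VSDO.del G D) w u v ≤ (ρ : EReal) → O.OutputsYes u v D) ∧
          (O.OutputsYes u v D → VSDO.wdist (VSDO.del G D) w u v ≤ ((A * ρ : ℝ) : EReal)) := by
  refine ⟨12 * (1 + 20 * Real.exp 1 ^ 2), by positivity, ?_⟩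
  intro V _ _ G w d ρ A hn hd hρ hw hA
  refine ⟨VSDO.nonempty_oracle hn hw c d ρ, fun O u v D hD hu hv => ⟨fun h =>
    VSDO.outputsYes_of_wdist_le hn hw O hu h, fun h =>
    (VSDO.wdist_le_of_outputsYes hn hw hρ hc hd O hD hu hv h).trans ?_⟩⟩
  rw [EReal.coe_le_coe_iff, hA, ← mul_assoc]
  exact mul_le_mul_of_nonneg_right (VSDO.stretch_bound hn hc hd hD) hρ
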